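/- Let $k\ge 1$ be an integer, and let $A=\{f(n)\}_{n\in\mathbb Z}$ and $B=\{f^*(n)\}_{n\in\mathbb Z}$ be sequences of complex numbers of period $k$. For an integer $\alpha$ write $A_\alpha=\{f(\alpha n)\}$, $B_\alpha=\{f^*(\alpha n)\}$. Arguments of complex numbers are taken in $[-\pi,\pi)$. For sequences $U=\{u(n)\}$, $V=\{v(n)\}$ of period $k$ and $z\in\mathbb H=\{\operatorname{Im} z>0\}$, let $G(z,s;U,V)$ be the analytic continuation to $s\in\mathbb C\setminus\{1\}$ of $$\sum_{(m,n)\in\mathbb Z^2\setminus\{(0,0)\}}\frac{u(m)\,v(n)}{(mz+n)^{s}},\qquad \operatorname{Re}(s)>2 .$$ The numbers $B_j(U)$ are defined by $$\sum_{n=0}^{k-1}\frac{t\,u(n)e^{nt}}{e^{kt}-1}=\sum_{j\ge 0}\frac{B_j(U)}{j!}t^j .$$ Let $P_n(x)=B_n(x-[x])/n!$ with $B_n(x)$ the ordinary Bernoulli polynomials (so $P_1(x)=x-[x]-\tfrac12$ for all real $x$), and for $n\ge1$ let $$P_n(x,U)=k^{n-1}\sum_{m=0}^{k-1}u(-m)\,P_n\!\left(\frac{m+x}{k}\right).$$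 For integers $d$ and $c>0$ put $$s(d,c;U,V)=\sum_{n=1}^{ck}u(n)\,P_1\!\left(\frac{n}{ck}\right)P_1\!\left(\frac{dn}{c},V\right).$$ Let $a,b,c,d$ be integers with $ad-bc=1$ and $c>0$, let $z\in\mathbb H$, and put $Vz=(az+b)/(cz+d)$. If $a\equiv d\equiv 0\pmod k$, then the continuations $G(Vz,s;A,B)$ and $G(z,s;B_{-b},A_{-c})$ exist and $$\lim_{s\to0}\Gamma(s)\Bigl((cz+d)^{-s}G(Vz,s;A,B)-G(z,s;B_{-b},A_{-c})\Bigr)$$ $$=2\pi i\,s(d,c;B_b,A_c)-\frac{\pi i}{c(cz+d)}B_0(B)B_2(A)-2\pi i\,\frac{cz+d}{c}\,B_0(A)P_2(0,B_b).$$ If $b\equiv c\equiv 0\pmod k$, then the continuations $G(Vz,s;A,B)$ and $G(z,s;A_d,B_a)$ exist and $$\lim_{s\to0}\Gamma(s)\Bigl((cz+d)^{-s}G(Vz,s;A,B)-G(z,s;A_d,B_a)\Bigr)$$ $$=2\pi i\,s(d,c;A_{-d},B_{-a})-\frac{\pi i}{c(cz+d)}B_0(B)B_2(A)-2\pi i\,\frac{cz+d}{c}\,B_0(B)P_2(0,A_d).$$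 -/

import Mathlib

open Filter Topology

namespace PeriodicEisenstein

/-- The sequence `A_α = {f (α n)}` attached to `A = {f n}`. -/
def dilate (f : ℤ → ℂ) (α : ℤ) : ℤ → ℂ := fun n => f (α * n)

/-- The argument of a complex number, normalised by `-π ≤ arg w < π`
(the argument of a negative real number is `-π`). -/
noncomputable def lowerArg (w : ℂ) : ℝ :=
  if w.arg = Real.pi then -Real.pi else w.arg

/-- The power `w ^ s` of a non-zero complex number `w`,
for the branch of the argument with `-π ≤ arg w < π`. -/
noncomputable def branchPow (w s : ℂ) : ℂ :=
  Complex.exp (s * ((Real.log ‖w‖ : ℂ) + (lowerArg w : ℂ) * Complex.I))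

/-- The term of index `(m, n)` of the Eisenstein series, the pair `(0, 0)` being excluded. -/
noncomputable def eisensteinTerm (f g : ℤ → ℂ) (z s : ℂ) (p : ℤ × ℤ) : ℂ :=
  if p = (0, 0) then 0
  else f p.1 * g p.2 * branchPow ((p.1 : ℂ) * z + (p.2 : ℂ)) (-s)

/-- `F` is holomorphic on `ℂ` outside `s = 1`, and for `Re s > 2` its value at `s` is the sum of the
(absolutely convergent) double series `∑' f(m) g(n) (m z + n) ^ (-s)` over `(m, n) ≠ (0, 0)`. -/
def IsEisensteinContinuation (f g : ℤ → ℂ) (z : ℂ) (F : ℂ → ℂ) : Prop :=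
  DifferentiableOn ℂ F {1}ᶜ ∧
    ∀ s : ℂ, 2 < s.re → HasSum (eisensteinTerm f g z s) (F s)

/-- Two analytic continuations of the same series agree away from `s = 1`. -/
theorem IsEisensteinContinuation.eqOn {f g : ℤ → ℂ} {z : ℂ} {F₁ F₂ : ℂ → ℂ}
    (h₁ : IsEisensteinContinuation f g z F₁) (h₂ : IsEisensteinContinuation f g z F₂) :
    Set.EqOn F₁ F₂ {1}ᶜ := by
  have hopen : IsOpen ({1}ᶜ : Set ℂ) := isOpen_compl_singleton
  have hconn : IsPreconnected ({1}ᶜ : Set ℂ) :=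
    (isConnected_compl_singleton_of_one_lt_rank (by simp) (1 : ℂ)).isPreconnected
  have h3 : (3 : ℂ) ∈ ({1}ᶜ : Set ℂ) := by
    simp
  refine (h₁.1.analyticOnNhd hopen).eqOn_of_preconnected_of_eventuallyEq
    (h₂.1.analyticOnNhd hopen) hconn h3 ?_
  have hU : {s : ℂ | 2 < s.re} ∈ 𝓝 (3 : ℂ) :=
    (isOpen_lt continuous_const Complex.continuous_re).mem_nhds (by norm_num)
  filter_upwards [hU] with s hs
  exact (h₁.2 s hs).unique (h₂.2 s hs)

/-- The function `s ↦ G(z, s; A, B)`, `A = {f n}`, `B = {g n}`: the analytic continuation to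
`s ≠ 1` of the Eisenstein series. -/
noncomputable def eisensteinG (f g : ℤ → ℂ) (z : ℂ) : ℂ → ℂ :=
  Classical.epsilon (IsEisensteinContinuation f g z)

/-- The power series `(e ^ (k t) - 1) / t`. -/
noncomputable def expQuotient (k : ℕ) : PowerSeries ℂ :=
  PowerSeries.mk fun m => (k : ℂ) ^ (m + 1) / ((m + 1).factorial : ℂ)

/-- The periodic Bernoulli numbers `B_j(A)`, defined by the generating function
`∑_{0 ≤ n < k} t f(n) e ^ (n t) / (e ^ (k t) - 1) = ∑_j B_j(A) t ^ j / j!`. -/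
noncomputable def periodicBernoulli (k : ℕ) (f : ℤ → ℂ) (j : ℕ) : ℂ :=
  (j.factorial : ℂ) * PowerSeries.coeff j
    ((∑ n ∈ Finset.range k,
        PowerSeries.C (f (n : ℤ)) * PowerSeries.rescale (n : ℂ) (PowerSeries.exp ℂ)) *
      (expQuotient k)⁻¹)

theorem X_mul_expQuotient (k : ℕ) :
    PowerSeries.X * expQuotient k = PowerSeries.rescale (k : ℂ) (PowerSeries.exp ℂ) - 1 := by
  ext n
  cases n with
  | zero => rw [map_sub, PowerSeries.coeff_rescale]; simp [PowerSeries.coeff_exp]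
  | succ n =>
    rw [PowerSeries.coeff_succ_X_mul]
    simp [expQuotient, PowerSeries.coeff_exp, PowerSeries.coeff_one, div_eq_mul_inv]

/-- The generating function identity, with the denominator cleared. -/
theorem periodicBernoulli_generating (k : ℕ) (hk : 0 < k) (f : ℤ → ℂ) :
    (PowerSeries.mk fun j => periodicBernoulli k f j / (j.factorial : ℂ)) *
        (PowerSeries.rescale (k : ℂ) (PowerSeries.exp ℂ) - 1) =
      ∑ n ∈ Finset.range k, PowerSeries.X *
        (PowerSeries.C (f (n : ℤ)) * PowerSeries.rescale (n : ℂ) (PowerSeries.exp ℂ)) := by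
  have h0 : PowerSeries.constantCoeff (expQuotient k) ≠ 0 := by
    rw [← PowerSeries.coeff_zero_eq_constantCoeff_apply]
    simp [expQuotient, hk.ne']
  have h1 : (PowerSeries.mk fun j => periodicBernoulli k f j / (j.factorial : ℂ)) =
      (∑ n ∈ Finset.range k,
        PowerSeries.C (f (n : ℤ)) * PowerSeries.rescale (n : ℂ) (PowerSeries.exp ℂ)) *
      (expQuotient k)⁻¹ := by
    ext j
    have hj : (j.factorial : ℂ) ≠ 0 := by exact_mod_cast j.factorial_ne_zero
    rw [PowerSeries.coeff_mk, periodicBernoulli, mul_div_cancel_left₀ _ hj]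
  rw [h1, ← X_mul_expQuotient, ← Finset.mul_sum]
  have h2 := PowerSeries.inv_mul_cancel _ h0
  linear_combination (PowerSeries.X * ∑ n ∈ Finset.range k,
    PowerSeries.C (f (n : ℤ)) * PowerSeries.rescale (n : ℂ) (PowerSeries.exp ℂ)) * h2

/-- The Bernoulli functions `P_n`, given by `n! P_n(x) = B_n(x - [x])`;
in particular `P_1(x) = x - [x] - 1/2` for every real `x`. -/
noncomputable def bernoulliP (n : ℕ) (x : ℝ) : ℝ :=
  bernoulliFun n (Int.fract x) / (n.factorial : ℝ)

/-- The periodic Bernoulli functions `P_n(x, A)`. -/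
noncomputable def periodicP (k : ℕ) (f : ℤ → ℂ) : ℕ → ℝ → ℂ
  | 0, _ => periodicBernoulli k f 0
  | n + 1, x => (k : ℂ) ^ n *
      ∑ m ∈ Finset.range k, f (-(m : ℤ)) * (bernoulliP (n + 1) (((m : ℝ) + x) / (k : ℝ)) : ℂ)

/-- The periodic Dedekind sum
`s(d, c; U, V) = ∑_{1 ≤ n ≤ c k} u(n) P_1(n / (c k)) P_1(d n / c, V)`, for `U = {u n}`,
`V = {v n}` of period `k` and `c > 0`. -/
noncomputable def dedekindSum (k : ℕ) (d c : ℤ) (u v : ℤ → ℂ) : ℂ :=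
  ∑ n ∈ Finset.Icc (1 : ℤ) (c * (k : ℤ)),
    u n * (bernoulliP 1 ((n : ℝ) / ((c : ℝ) * (k : ℝ))) : ℂ) *
      periodicP k v 1 ((d : ℝ) * (n : ℝ) / (c : ℝ))

end PeriodicEisenstein

/-! Write `τ = cz + d` and `w = mz + n`. For `(M, N) = (dm - cn, -bm + an)` one has `M·Vz + N =
w/τ`, so a unimodular change of indices turns `τ^(-s) G(Vz, s)` into a sum of `τ^(-s) (w/τ)^(-s)`
over the same lattice, with coefficients `f(dm - cn) g(-bm + an)`. Either congruence condition makes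
these a product `u(m) v(n)`, so the sum is compared term by term with `G(z, s; u, v)`. Only the
failure of the branch to be multiplicative survives: `τ^(-s) (w/τ)^(-s) = w^(-s)` unless `-w` lies
in the cone `{x + yτ : x > 0, y ≥ 0}`, where the arguments differ by `2π`. Hence for `Re s > 2` the
difference is `-2i sin(πs)` times a Dirichlet series over the lattice points of that cone
(`continuation_sub_eq_cone`).

Modulo its periods `k` and `kτ` the cone has `ck²` classes of lattice points, and each class gives a
Barnes double zeta function. After a rotation by half the argument of `τ`, `Γ(s)` times it is the
Mellin transform of `exp(-(xα + yβ)t) / ((1 - exp(-αt))(1 - exp(-βt)))`. The expansion of this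
kernel at `t = 0` up to `O(t)` continues it to `Re s > -1` with at most simple poles at `2, 1, 0`.
The factor `sin(πs)` cancels the pole at `0`, so the limit is `-2πi` times the sum of the constant
coefficients `B₁(x)B₁(y) + B₂(x)/(2τ) + B₂(y)τ/2` (`tendsto_gamma_mul_continuation_sub`).

In the finite sum the `B₁B₁` terms give minus the Dedekind sum, and the distribution relation
collapses the `B₂` terms to sums modulo `k` (`sum_coneValue`). One of these is a double sum of
`P₂((cn - dm)/k)`; it factors because `c` or `d` vanishes modulo `k`.

The continuations exist for a separate reason: the Lipschitz formula turns the rows `m ≠ 0` into a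
`q`-series converging for every `s`, and the row `m = 0` is a periodic Dirichlet series, singular at
most at `s = 1` (`exists_isEisensteinContinuation`). -/

namespace PeriodicEisenstein

/-! ### The branch of the power and its failure to be multiplicative -/

/-- The half-plane `0 ≤ arg w < π`, the origin being excluded. -/
def IsUpper (w : ℂ) : Prop := 0 < w.im ∨ (w.im = 0 ∧ 0 < w.re)

theorem IsUpper.ne_zero {w : ℂ} (h : IsUpper w) : w ≠ 0 := by
  rintro rfl
  simp [IsUpper] at h

theorem IsUpper.arg_nonneg {w : ℂ} (h : IsUpper w) : 0 ≤ w.arg := by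
  rw [Complex.arg_nonneg_iff]
  rcases h with h | h
  · exact h.le
  · exact h.1.ge

theorem IsUpper.arg_lt {w : ℂ} (h : IsUpper w) : w.arg < Real.pi := by
  refine lt_of_le_of_ne (Complex.arg_le_pi w) fun h' => ?_
  rw [Complex.arg_eq_pi_iff] at h'
  rcases h with h | h
  · exact h.ne' h'.2
  · linarith [h.2, h'.1]

theorem isUpper_or_neg {w : ℂ} (h : w ≠ 0) : IsUpper w ∨ IsUpper (-w) := by
  rcases lt_trichotomy w.im 0 with h1 | h1 | h1
  · right; left; simpa using h1
  · rcases lt_trichotomy w.re 0 with h2 | h2 | h2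
    · right; right; simpa [h1] using h2
    · exact (h (Complex.ext h2 h1)).elim
    · left; right; exact ⟨h1, h2⟩
  · left; left; exact h1

theorem IsUpper.not_neg {w : ℂ} (h : IsUpper w) : ¬ IsUpper (-w) := by
  rintro (h1 | h1) <;> rcases h with h | h <;> simp at h1 <;> linarith [h1]

theorem branchPow_of_isUpper {w : ℂ} (h : IsUpper w) (s : ℂ) : branchPow w s = w ^ s := by
  rw [branchPow, Complex.cpow_def_of_ne_zero h.ne_zero, lowerArg, if_neg h.arg_lt.ne, mul_comm,
    Complex.log]

theorem lowerArg_neg {w : ℂ} (h : IsUpper w) : lowerArg (-w) = w.arg - Real.pi := by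
  rw [lowerArg]
  rcases h with h | h
  · rw [Complex.arg_neg_eq_arg_sub_pi_of_im_pos h, if_neg]
    intro h'
    linarith [Complex.arg_le_pi w, Real.pi_pos]
  · have h1 : w.arg = 0 := Complex.arg_eq_zero_iff.2 ⟨h.2.le, h.1⟩
    have h2 : (-w).arg = Real.pi := Complex.arg_eq_pi_iff.2 (by simp [h.1, h.2])
    rw [if_pos h2, h1, zero_sub]

theorem branchPow_neg {w : ℂ} (h : IsUpper w) (s : ℂ) :
    branchPow (-w) s = Complex.exp (-(Real.pi * Complex.I * s)) * w ^ s := by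
  rw [branchPow, Complex.cpow_def_of_ne_zero h.ne_zero, lowerArg_neg h, ← Complex.exp_add, norm_neg,
    Complex.log]
  push_cast
  ring_nf

/-- Since `arg w ∈ [0, π)` and `arg τ ∈ (0, π)`, the difference `arg w - arg τ` lies in `(-π, π)`
and is already the normalised argument of `w/τ`. -/
theorem cpow_mul_branchPow_div {τ w : ℂ} (hτ : 0 < τ.im) (h : IsUpper w) (s : ℂ) :
    branchPow τ s * branchPow (w / τ) s = w ^ s := by
  have hτ' : IsUpper τ := Or.inl hτ
  have h1 : 0 < τ.arg := lt_of_le_of_ne hτ'.arg_nonneg fun h' => by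
    rw [eq_comm, Complex.arg_eq_zero_iff] at h'
    exact hτ.ne' h'.2
  have h2 : τ⁻¹.arg = -τ.arg := by rw [Complex.arg_inv, if_neg hτ'.arg_lt.ne]
  have h3 : (w / τ).arg = w.arg - τ.arg := by
    rw [div_eq_mul_inv, (Complex.arg_mul_eq_add_arg_iff h.ne_zero (inv_ne_zero hτ'.ne_zero)).2, h2,
      sub_eq_add_neg]
    rw [h2]
    constructor <;> linarith [h.arg_nonneg, h.arg_lt, hτ'.arg_lt, Real.pi_pos]
  rw [branchPow_of_isUpper hτ', Complex.cpow_def_of_ne_zero hτ'.ne_zero,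
    Complex.cpow_def_of_ne_zero h.ne_zero, branchPow, lowerArg, h3, if_neg, ← Complex.exp_add,
    norm_div, Real.log_div (norm_ne_zero_iff.2 h.ne_zero) (norm_ne_zero_iff.2 hτ'.ne_zero),
    Complex.log, Complex.log]
  · push_cast
    ring_nf
  · linarith [h.arg_lt]

/-- When `w` and `w/τ` are both in the upper half-plane, changing the sign subtracts `π` from both
arguments, so the multiplicativity for `w` carries over to `-w`. -/
theorem branchPow_mul_neg_div_of_isUpper {τ w : ℂ} (hτ : 0 < τ.im) (h : IsUpper w)
    (hw : IsUpper (w / τ)) (s : ℂ) :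
    branchPow τ s * branchPow (-w / τ) s = branchPow (-w) s := by
  rw [neg_div, branchPow_neg hw, branchPow_neg h, ← cpow_mul_branchPow_div hτ h,
    branchPow_of_isUpper hw]
  ring

/-- Here `-w/τ` is in the upper half-plane, so its argument is `arg w - arg τ + π`, while that of
`-w` is `arg w - π`: the two sides of the multiplicativity relation are a full turn apart. -/
theorem branchPow_mul_neg_div_of_isUpper_neg {τ w : ℂ} (hτ : 0 < τ.im) (h : IsUpper w)
    (hw : IsUpper (-(w / τ))) (s : ℂ) :
    branchPow τ s * branchPow (-w / τ) s = Complex.exp (Real.pi * Complex.I * s) * w ^ s := by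
  have h1 := branchPow_neg hw s
  rw [neg_neg] at h1
  rw [neg_div, branchPow_of_isUpper hw, ← cpow_mul_branchPow_div hτ h, h1, Complex.exp_neg]
  field_simp [Complex.exp_ne_zero]

/-! ### Absolute convergence for `Re s > 2` -/

theorem norm_branchPow_neg_le {w : ℂ} (hw : w ≠ 0) (s : ℂ) :
    ‖branchPow w (-s)‖ ≤ Real.exp (Real.pi * |s.im|) * ‖w‖ ^ (-s.re) := by
  have h1 : |lowerArg w| ≤ Real.pi := by
    rw [lowerArg]
    split_ifs
    · simp [abs_of_pos Real.pi_pos]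
    · exact Complex.abs_arg_le_pi w
  rw [branchPow, Complex.norm_exp, Real.rpow_def_of_pos (norm_pos_iff.2 hw), ← Real.exp_add,
    Real.exp_le_exp]
  have h2 : lowerArg w * s.im ≤ Real.pi * |s.im| :=
    (le_abs_self _).trans (by rw [abs_mul]; gcongr)
  simp only [Complex.mul_re, Complex.neg_re, Complex.neg_im, Complex.add_re, Complex.add_im,
    Complex.ofReal_re, Complex.ofReal_im, Complex.mul_im, Complex.I_re, Complex.I_im]
  linarith

theorem exists_norm_le_of_periodic {k : ℕ} (hk : 0 < k) {f : ℤ → ℂ}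
    (hf : Function.Periodic f (k : ℤ)) : ∃ C : ℝ, 0 ≤ C ∧ ∀ n, ‖f n‖ ≤ C := by
  refine ⟨∑ n ∈ Finset.range k, ‖f n‖, by positivity, fun n => ?_⟩
  have h1 : 0 ≤ n % (k : ℤ) := Int.emod_nonneg _ (by positivity)
  have h2 : n % (k : ℤ) < k := Int.emod_lt_of_pos _ (by exact_mod_cast hk)
  have h3 : f n = f ((n % (k : ℤ)).toNat : ℤ) := by
    rw [Int.toNat_of_nonneg h1]
    conv_lhs => rw [← Int.emod_add_mul_ediv n k]
    have := hf.int_mul (n / k) (n % k)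
    rw [mul_comm]
    simpa using this
  rw [h3]
  exact Finset.single_le_sum (f := fun n : ℕ => ‖f n‖) (fun _ _ => norm_nonneg _)
    (Finset.mem_range.2 (by omega))

theorem int_mul_add_int_ne_zero {z : ℂ} (hz : 0 < z.im) {p : ℤ × ℤ} (hp : p ≠ 0) :
    (p.1 : ℂ) * z + p.2 ≠ 0 := by
  intro h
  have h1 := congrArg Complex.im h
  simp [hz.ne'] at h1
  rw [h1] at h
  simp at h
  exact hp (Prod.ext h1 h)

theorem summable_eisensteinTerm {k : ℕ} (hk : 0 < k) {f g : ℤ → ℂ}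
    (hf : Function.Periodic f (k : ℤ)) (hg : Function.Periodic g (k : ℤ)) {z : ℂ} (hz : 0 < z.im)
    {s : ℂ} (hs : 2 < s.re) : Summable (eisensteinTerm f g z s) := by
  obtain ⟨C, hC, hfC⟩ := exists_norm_le_of_periodic hk hf
  obtain ⟨D, hD, hgD⟩ := exists_norm_le_of_periodic hk hg
  have h1 := (finTwoArrowEquiv ℤ).symm.summable_iff.2
    (EisensteinSeries.summable_one_div_norm_rpow hs)
  set Z : UpperHalfPlane := ⟨z, hz⟩
  refine Summable.of_norm_bounded (h1.mul_left
    (C * D * (Real.exp (Real.pi * |s.im|) * EisensteinSeries.r Z ^ (-s.re)))) fun p => ?_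
  rw [eisensteinTerm]
  split_ifs with hp
  · rw [norm_zero]
    exact mul_nonneg (mul_nonneg (mul_nonneg hC hD) (mul_nonneg (Real.exp_nonneg _)
      (Real.rpow_nonneg (EisensteinSeries.r_pos Z).le _))) (Real.rpow_nonneg (norm_nonneg _) _)
  · have h2 := EisensteinSeries.summand_bound Z (by linarith : 0 ≤ s.re) ((finTwoArrowEquiv ℤ).symm p)
    simp only [finTwoArrowEquiv_symm_apply, Matrix.cons_val_zero, Matrix.cons_val_one] at h2
    have h3 := norm_branchPow_neg_le (int_mul_add_int_ne_zero hz hp) s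
    rw [norm_mul, norm_mul, mul_assoc]
    calc ‖f p.1‖ * (‖g p.2‖ * ‖branchPow ((p.1 : ℂ) * z + p.2) (-s)‖)
      _ ≤ C * (D * (Real.exp (Real.pi * |s.im|) *
            (EisensteinSeries.r Z ^ (-s.re) * ‖![p.1, p.2]‖ ^ (-s.re)))) := by
          gcongr
          · exact hfC _
          · exact hgD _
          · exact h3.trans (by gcongr)
      _ = _ := by
          simp only [Function.comp, finTwoArrowEquiv_symm_apply]
          ring

/-! ### The difference of the two series as a sum over a cone -/

/-- The term of index `(m, n)` of the Dirichlet series attached to the cone spanned by `1`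
(included) and `c z + d` (excluded). -/
noncomputable def coneTerm (u v : ℤ → ℂ) (c d : ℤ) (z s : ℂ) (p : ℤ × ℤ) : ℂ :=
  if 0 ≤ p.1 ∧ p.1 * d < p.2 * c then
    u (-p.1) * v (-p.2) * ((p.1 : ℂ) * z + (p.2 : ℂ)) ^ (-s)
  else 0

theorem isUpper_int_mul_add_int {z : ℂ} (hz : 0 < z.im) {p : ℤ × ℤ} :
    IsUpper ((p.1 : ℂ) * z + p.2) ↔ 0 < p.1 ∨ (p.1 = 0 ∧ 0 < p.2) := by
  simp only [IsUpper, Complex.add_im, Complex.mul_im, Complex.intCast_re, Complex.intCast_im,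
    zero_mul, add_zero, Complex.add_re, Complex.mul_re, sub_zero, mul_pos_iff_of_pos_right hz,
    mul_eq_zero, hz.ne', or_false, Int.cast_pos, Int.cast_eq_zero]
  refine or_congr_right (and_congr_right fun h => ?_)
  simp [h]

theorem im_div_linear {c d : ℤ} {z : ℂ} (p : ℤ × ℤ) :
    (((p.1 : ℂ) * z + p.2) / (c * z + d)).im =
      (((p.1 * d - p.2 * c : ℤ) : ℝ) * z.im) / Complex.normSq (c * z + d) := by
  rw [Complex.div_im]
  simp only [Complex.add_im, Complex.mul_im, Complex.intCast_re, Complex.intCast_im,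
    zero_mul, add_zero, Complex.add_re, Complex.mul_re, sub_zero]
  push_cast
  ring

theorem isUpper_of_mem_cone {c d : ℤ} (hc : 0 < c) {z : ℂ} (hz : 0 < z.im) {p : ℤ × ℤ}
    (h : 0 ≤ p.1 ∧ p.1 * d < p.2 * c) : IsUpper ((p.1 : ℂ) * z + p.2) := by
  rw [isUpper_int_mul_add_int hz]
  rcases h.1.lt_or_eq with h1 | h1
  · exact Or.inl h1
  · right
    refine ⟨h1.symm, ?_⟩
    have h2 := h.2
    rw [← h1, zero_mul] at h2
    exact pos_of_mul_pos_left h2 hc.le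

theorem linear_im_pos {c d : ℤ} (hc : 0 < c) {z : ℂ} (hz : 0 < z.im) :
    0 < ((c : ℂ) * z + d).im := by
  simpa using mul_pos (by exact_mod_cast hc) hz

/-- How `(c z + d) ^ (-s) (w / (c z + d)) ^ (-s)` differs from `w ^ (-s)` for `-w` in the
half-plane `0 ≤ arg < π`. -/
theorem branchPow_mul_sub {c d : ℤ} (hc : 0 < c) {z : ℂ} (hz : 0 < z.im)
    {p : ℤ × ℤ} (hp : p ≠ 0) (s : ℂ) :
    branchPow (c * z + d) (-s) * branchPow (((p.1 : ℂ) * z + p.2) / (c * z + d)) (-s) -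
        branchPow ((p.1 : ℂ) * z + p.2) (-s) =
      if 0 ≤ (-p).1 ∧ (-p).1 * d < (-p).2 * c then
        -2 * Complex.I * Complex.sin (Real.pi * s) * (((-p).1 : ℂ) * z + ((-p).2 : ℂ)) ^ (-s)
      else 0 := by
  have hτ := linear_im_pos (d := d) hc hz
  have hn : 0 < Complex.normSq (c * z + d) := by
    rw [Complex.normSq_pos]
    intro h
    simp [h] at hτ
  have hneg : (((-p).1 : ℂ) * z + ((-p).2 : ℂ)) = -((p.1 : ℂ) * z + p.2) := by
    simp; ring
  rcases isUpper_or_neg (int_mul_add_int_ne_zero hz hp) with h | h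
  · rw [cpow_mul_branchPow_div hτ h, branchPow_of_isUpper h, sub_self, if_neg]
    intro h'
    have := isUpper_of_mem_cone hc hz h'
    rw [hneg] at this
    exact h.not_neg this
  · have h' := h
    rw [← hneg, isUpper_int_mul_add_int hz] at h'
    set w := -((p.1 : ℂ) * z + p.2) with hw
    have hw' : (p.1 : ℂ) * z + p.2 = -w := by rw [hw, neg_neg]
    have him := im_div_linear (c := c) (d := d) (z := z) (-p)
    rw [hneg] at him
    rw [hneg, hw']
    -- With `w` upper, membership of its index in the cone means `Im (w/τ) < 0`, that is `arg w <
    -- arg τ`.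
    split_ifs with hcone
    · have h2 : IsUpper (-(w / (c * z + d))) := by
        left
        rw [Complex.neg_im, him, neg_pos]
        refine div_neg_of_neg_of_pos (mul_neg_of_neg_of_pos ?_ hz) hn
        exact_mod_cast sub_neg.2 hcone.2
      rw [branchPow_mul_neg_div_of_isUpper_neg hτ h h2, branchPow_neg h, Complex.sin]
      have e1 : Complex.exp (Real.pi * Complex.I * -s) = Complex.exp (-(Real.pi * s) * Complex.I) := by
        ring_nf
      have e2 : Complex.exp (-(Real.pi * Complex.I * -s)) = Complex.exp (Real.pi * s * Complex.I) := by
        ring_nf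
      rw [e1, e2]
      linear_combination ((Complex.exp (-(Real.pi * s) * Complex.I) -
        Complex.exp (Real.pi * s * Complex.I)) * w ^ (-s)) * Complex.I_mul_I
    · have h1 : 0 ≤ (-p).1 := by omega
      have h3 : 0 ≤ (-p).1 * d - (-p).2 * c := by
        by_contra h4
        exact hcone ⟨h1, by linarith⟩
      have h2 : IsUpper (w / (c * z + d)) := by
        rcases h3.lt_or_eq with h4 | h4
        · left
          rw [him]
          refine div_pos (mul_pos ?_ hz) hn
          exact_mod_cast h4
        -- Boundary ray: `w` is a positive multiple of `cz + d`, so `w/τ` is a positive real and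
        -- still counts as upper. This is why the cone excludes that ray.
        · right
          refine ⟨by rw [him, ← h4]; simp, ?_⟩
          have h5 : 0 < (-p).1 := by
            rcases h' with h' | h'
            · exact h'
            · rw [h'.1] at h4
              nlinarith [h'.2]
          have h6 : w * c = (-p).1 * (c * z + d) := by
            have h7 : (((-p).1 * d - (-p).2 * c : ℤ) : ℂ) = 0 := by rw [← h4]; simp
            push_cast at h7
            rw [← hneg]
            linear_combination -h7
          have hc' : (c : ℂ) ≠ 0 := by exact_mod_cast hc.ne'
          have hτ0 : (c * z + d : ℂ) ≠ 0 := (IsUpper.ne_zero (Or.inl hτ))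
          have h7 : w / (c * z + d) = (((-p).1 / c : ℝ) : ℂ) := by
            rw [div_eq_iff hτ0]
            push_cast
            rw [div_mul_eq_mul_div, eq_div_iff hc', h6]
          rw [h7, Complex.ofReal_re]
          have : (0 : ℝ) < ((-p).1 : ℤ) := by exact_mod_cast h5
          have : (0 : ℝ) < c := by exact_mod_cast hc
          positivity
      rw [branchPow_mul_neg_div_of_isUpper hτ h h2, sub_self]

/-- The action of a matrix of determinant one on the indices of the double series. -/
def indexEquiv (a b c d : ℤ) (hdet : a * d - b * c = 1) : ℤ × ℤ ≃ ℤ × ℤ where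
  toFun p := (d * p.1 - c * p.2, -b * p.1 + a * p.2)
  invFun p := (a * p.1 + c * p.2, b * p.1 + d * p.2)
  left_inv p := by
    ext
    · simp only
      linear_combination p.1 * hdet
    · simp only
      linear_combination p.2 * hdet
  right_inv p := by
    ext
    · simp only
      linear_combination p.1 * hdet
    · simp only
      linear_combination p.2 * hdet

/-- On the cone `w` is upper, so `w^(-s)` is the branch power of `-w` up to a factor depending only
on `s`. The series is therefore a subseries of an Eisenstein series reindexed by `p ↦ -p`. -/
theorem summable_coneTerm {k : ℕ} (hk : 0 < k) {u v : ℤ → ℂ}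
    (hu : Function.Periodic u (k : ℤ)) (hv : Function.Periodic v (k : ℤ)) {c d : ℤ} (hc : 0 < c)
    {z : ℂ} (hz : 0 < z.im) {s : ℂ} (hs : 2 < s.re) : Summable (coneTerm u v c d z s) := by
  have h1 := (((Equiv.neg (ℤ × ℤ)).summable_iff.2 (summable_eisensteinTerm hk hu hv hz hs)).mul_left
    (Complex.exp (-(Real.pi * Complex.I * s)))).indicator {p : ℤ × ℤ | 0 ≤ p.1 ∧ p.1 * d < p.2 * c}
  refine h1.congr fun p => ?_
  rw [Set.indicator_apply, coneTerm]
  simp only [Set.mem_ofPred_eq]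
  split_ifs with h
  · have h2 := isUpper_of_mem_cone hc hz h
    have h3 : -p ≠ (0, 0) := by
      rintro h3
      rw [← Prod.zero_eq_mk, neg_eq_zero] at h3
      rw [h3] at h
      simp at h
    have h4 : ((-p).1 : ℂ) * z + ((-p).2 : ℂ) = -((p.1 : ℂ) * z + p.2) := by simp; ring
    simp only [Function.comp, Equiv.neg_apply]
    rw [eisensteinTerm, if_neg h3, h4, branchPow_neg h2]
    have h5 : Complex.exp (-(Real.pi * Complex.I * s)) * Complex.exp (-(Real.pi * Complex.I * -s)) = 1 := by
      rw [← Complex.exp_add]; simp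
    simp only [Prod.fst_neg, Prod.snd_neg]
    linear_combination (u (-p.1) * v (-p.2) * ((p.1 : ℂ) * z + p.2) ^ (-s)) * h5
  · rfl

theorem continuation_sub_eq_cone {k : ℕ} (hk : 0 < k) {f g u v : ℤ → ℂ}
    (hu : Function.Periodic u (k : ℤ)) (hv : Function.Periodic v (k : ℤ))
    {a b c d : ℤ} (hdet : a * d - b * c = 1) (hc : 0 < c) {z : ℂ} (hz : 0 < z.im)
    (huv : ∀ m n, f (d * m - c * n) * g (-b * m + a * n) = u m * v n) {F₁ F₂ : ℂ → ℂ}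
    (h₁ : IsEisensteinContinuation f g ((a * z + b) / (c * z + d)) F₁)
    (h₂ : IsEisensteinContinuation u v z F₂) {s : ℂ} (hs : 2 < s.re) :
    branchPow (c * z + d) (-s) * F₁ s - F₂ s =
      -2 * Complex.I * Complex.sin (Real.pi * s) * ∑' p, coneTerm u v c d z s p := by
  have e1 := ((indexEquiv a b c d hdet).hasSum_iff.2 (h₁.2 s hs)).mul_left
    (branchPow (c * z + d) (-s))
  have e2 := e1.sub (h₂.2 s hs)
  have e3 := (Equiv.neg (ℤ × ℤ)).hasSum_iff.2 (summable_coneTerm (d := d) hk hu hv hc hz hs).hasSum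
  refine e2.unique ((e3.mul_left (-2 * Complex.I * Complex.sin (Real.pi * s))).congr_fun ?_)
  intro p
  have hτ0 : (c * z + d : ℂ) ≠ 0 := (IsUpper.ne_zero (Or.inl (linear_im_pos hc hz)))
  simp only [Function.comp, Equiv.neg_apply]
  by_cases hp : p = 0
  · subst hp
    simp [eisensteinTerm, indexEquiv, coneTerm, Prod.zero_eq_mk]
  · have hp' : indexEquiv a b c d hdet p ≠ (0, 0) := by
      intro h
      apply hp
      rw [← (indexEquiv a b c d hdet).symm_apply_apply p, h]
      simp [indexEquiv]
    have h5 : (((indexEquiv a b c d hdet p).1 : ℂ) * ((a * z + b) / (c * z + d)) +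
        ((indexEquiv a b c d hdet p).2 : ℂ)) = ((p.1 : ℂ) * z + p.2) / (c * z + d) := by
      rw [eq_div_iff hτ0, add_mul, mul_assoc, div_mul_cancel₀ _ hτ0]
      have : (a * d - b * c : ℂ) = 1 := by exact_mod_cast hdet
      simp only [indexEquiv, Equiv.coe_fn_mk]
      push_cast
      linear_combination ((p.1 : ℂ) * z + p.2) * this
    have h6 := branchPow_mul_sub (d := d) hc hz hp s
    rw [eisensteinTerm, eisensteinTerm, if_neg (show p ≠ (0, 0) from hp), if_neg hp', h5]
    have h7 := huv p.1 p.2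
    simp only [indexEquiv, Equiv.coe_fn_mk]
    rw [h7, coneTerm]
    simp only [Prod.fst_neg, Prod.snd_neg, neg_neg] at h6 ⊢
    split_ifs at h6 ⊢ with h8
    · linear_combination (u p.1 * v p.2) * h6
    · linear_combination (u p.1 * v p.2) * h6

/-! ### Mellin transforms of exponentials -/

open MeasureTheory Set in
theorem mellinConvergent_exp_neg_mul {w s : ℂ} (hw : 0 < w.re) (hs : 0 < s.re) :
    MellinConvergent (fun t : ℝ => Complex.exp (-w * t)) s := by
  have hc : Continuous fun t : ℝ => Complex.exp (-w * t) := by fun_prop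
  refine mellinConvergent_of_isBigO_rpow_exp (b := 0) hw (hc.locallyIntegrable.locallyIntegrableOn _)
    ?_ ?_ hs
  · refine Asymptotics.IsBigO.of_bound 1 (Eventually.of_forall fun t => ?_)
    rw [Complex.norm_exp, Real.norm_eq_abs, Real.abs_exp, one_mul]
    simp
  · simp only [neg_zero, Real.rpow_zero]
    refine (hc.tendsto 0).isBigO_one ℝ |>.mono nhdsWithin_le_nhds

open MeasureTheory Set in
theorem norm_cpow_mul_exp_neg_mul {w s : ℂ} {t : ℝ} (ht : 0 < t) :
    ‖(t : ℂ) ^ (s - 1) * Complex.exp (-w * t)‖ = t ^ (s.re - 1) * Real.exp (-(w.re * t)) := by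
  rw [norm_mul, Complex.norm_cpow_eq_rpow_re_of_pos ht, Complex.norm_exp]
  simp

open MeasureTheory Set in
theorem differentiableAt_mellin_exp_neg_mul {w s : ℂ} (hw : 0 < w.re) (hs : 0 < s.re) :
    DifferentiableAt ℂ (fun w : ℂ => mellin (fun t : ℝ => Complex.exp (-w * t)) s) w := by
  have hs' : 0 < (((s.re + 1 : ℝ) : ℂ)).re := by simp; linarith
  have hw' : 0 < (((w.re / 2 : ℝ) : ℂ)).re := by simpa using hw
  -- The dominating function for the derivative in `w` is `t^(Re s) exp(-(Re w / 2) t)`: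
  -- differentiating brings down one factor `t`, and on the half-plane `Re v > Re w / 2` the
  -- exponential is uniformly controlled.
  have hb := (mellinConvergent_exp_neg_mul hw' hs').norm
  have hball : {v : ℂ | w.re / 2 < v.re} ∈ 𝓝 w :=
    (isOpen_lt continuous_const Complex.continuous_re).mem_nhds (by simp; linarith)
  refine (hasDerivAt_integral_of_dominated_loc_of_deriv_le
    (μ := volume.restrict (Ioi 0)) (F := fun (w : ℂ) (t : ℝ) =>
      (t : ℂ) ^ (s - 1) • Complex.exp (-w * t))
    (F' := fun (w : ℂ) (t : ℝ) => (t : ℂ) ^ (s - 1) * (Complex.exp (-w * t) * (-t)))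
    hball ?_ (mellinConvergent_exp_neg_mul hw hs) ?_ ?_ hb ?_).2.differentiableAt
  · filter_upwards [hball] with v hv
    exact (mellinConvergent_exp_neg_mul (lt_trans (by linarith) hv) hs).aestronglyMeasurable
  · refine ContinuousOn.aestronglyMeasurable ?_ measurableSet_Ioi
    refine ContinuousOn.mul (fun t ht => ?_) (Continuous.continuousOn (by fun_prop))
    exact (Complex.continuousAt_ofReal_cpow_const _ _ (Or.inr (ne_of_gt ht))).continuousWithinAt
  · refine (ae_restrict_iff' measurableSet_Ioi).2 (ae_of_all _ fun t (ht : 0 < t) v hv => ?_)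
    rw [smul_eq_mul, norm_cpow_mul_exp_neg_mul ht, ← mul_assoc, norm_mul,
      norm_cpow_mul_exp_neg_mul ht]
    have h1 : ‖(-t : ℂ)‖ = t := by rw [norm_neg, Complex.norm_real, Real.norm_of_nonneg ht.le]
    rw [h1]
    simp only [Complex.ofReal_re]
    have h2 : t ^ (s.re + 1 - 1) = t ^ (s.re - 1) * t := by
      rw [← Real.rpow_add_one ht.ne']
      ring_nf
    rw [h2, mul_right_comm]
    have hv' : w.re / 2 < v.re := hv
    gcongr
  · refine ae_of_all _ fun t v hv => ?_
    have h1 : HasDerivAt (fun v : ℂ => -v * (t : ℂ)) (-t : ℂ) v := by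
      simpa using ((hasDerivAt_id v).neg.mul_const (t : ℂ))
    simpa only [smul_eq_mul] using (h1.cexp.const_mul _)

open MeasureTheory Set in
/-- The Mellin transform of `t ↦ exp (-w t)` is `Γ(s) w ^ (-s)`. -/
theorem mellin_exp_neg_mul {w s : ℂ} (hw : 0 < w.re) (hs : 0 < s.re) :
    mellin (fun t : ℝ => Complex.exp (-w * t)) s = Complex.Gamma s * w ^ (-s) := by
  have hopen : IsOpen {v : ℂ | 0 < v.re} := isOpen_lt continuous_const Complex.continuous_re
  have hconn : IsPreconnected {v : ℂ | 0 < v.re} := (convex_halfSpace_re_gt 0).isPreconnected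
  have h1 : AnalyticOnNhd ℂ (fun w : ℂ => mellin (fun t : ℝ => Complex.exp (-w * t)) s)
      {v : ℂ | 0 < v.re} :=
    DifferentiableOn.analyticOnNhd (fun v hv =>
      (differentiableAt_mellin_exp_neg_mul hv hs).differentiableWithinAt) hopen
  have h2 : AnalyticOnNhd ℂ (fun w : ℂ => Complex.Gamma s * w ^ (-s)) {v : ℂ | 0 < v.re} := by
    refine DifferentiableOn.analyticOnNhd (fun v hv => ?_) hopen
    have : v ∈ Complex.slitPlane := Or.inl hv
    exact (DifferentiableAt.const_mul (differentiableAt_id.cpow_const this) _).differentiableWithinAt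
  -- Both sides are analytic in `w` on the right half-plane, and for real `w > 0` the identity is
  -- the Gamma integral. Real points accumulating at `1` suffice.
  refine h1.eqOn_of_preconnected_of_frequently_eq h2 hconn
    (show (1 : ℂ) ∈ {v : ℂ | 0 < v.re} by simp) ?_ hw
  have h3 : Tendsto (fun x : ℝ => (x : ℂ)) (𝓝[≠] 1) (𝓝[≠] 1) := by
    refine tendsto_nhdsWithin_of_tendsto_nhds_of_eventually_within _
      ((Complex.continuous_ofReal.tendsto' 1 1 (by simp)).mono_left nhdsWithin_le_nhds) ?_
    filter_upwards [self_mem_nhdsWithin] with x hx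
    simpa using hx
  refine h3.frequently (Eventually.frequently ?_)
  filter_upwards [nhdsWithin_le_nhds (lt_mem_nhds (zero_lt_one' ℝ))] with x hx
  have h4 := Complex.integral_cpow_mul_exp_neg_mul_Ioi hs hx
  rw [mellin]
  simp only [smul_eq_mul, neg_mul]
  rw [h4, one_div, Complex.inv_cpow, ← Complex.cpow_neg, mul_comm]
  rw [Complex.arg_ofReal_of_nonneg hx.le]
  exact Real.pi_pos.ne

open MeasureTheory Set in
/-- A Dirichlet series with complex exponents in the right half-plane is a Mellin transform. -/
theorem hasSum_mellin_exp {ι : Type*} [Countable ι] {w : ι → ℂ} {F : ℝ → ℂ} {s : ℂ}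
    (hw : ∀ i, 0 < (w i).re) (hs : 0 < s.re)
    (hF : ∀ t : ℝ, 0 < t → HasSum (fun i => Complex.exp (-w i * t)) (F t))
    (h_sum : Summable fun i => (w i).re ^ (-s.re)) :
    HasSum (fun i => Complex.Gamma s * w i ^ (-s)) (mellin F s) := by
  have h1 : mellin F s = ∫ t in Ioi (0 : ℝ), ∑' i, (t : ℂ) ^ (s - 1) * Complex.exp (-w i * t) := by
    refine setIntegral_congr_fun measurableSet_Ioi fun t ht => ?_
    rw [tsum_mul_left, (hF t ht).tsum_eq, smul_eq_mul]
  rw [h1]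
  have h2 := hasSum_integral_of_summable_integral_norm (μ := volume.restrict (Ioi (0 : ℝ)))
    (F := fun i (t : ℝ) => (t : ℂ) ^ (s - 1) * Complex.exp (-w i * t))
    (fun i => mellinConvergent_exp_neg_mul (hw i) hs) ?_
  · exact h2.congr_fun fun i => (mellin_exp_neg_mul (hw i) hs).symm
  · refine (h_sum.mul_left (Real.Gamma s.re)).congr fun i => ?_
    rw [setIntegral_congr_fun (g := fun t : ℝ => t ^ (s.re - 1) * Real.exp (-((w i).re * t)))
        measurableSet_Ioi fun t ht => norm_cpow_mul_exp_neg_mul ht,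
      Real.integral_rpow_mul_exp_neg_mul_Ioi hs (hw i), one_div, Real.inv_rpow (hw i).le,
      Real.rpow_neg (hw i).le, mul_comm]

/-! ### The Barnes double zeta function as a Mellin transform -/

/-- The function whose Mellin transform is the double zeta function with periods `α` and `β`. -/
noncomputable def barnesKernel (α β : ℂ) (x y : ℝ) (t : ℝ) : ℂ :=
  Complex.exp (-(x * α + y * β) * t) /
    ((1 - Complex.exp (-α * t)) * (1 - Complex.exp (-β * t)))

theorem norm_exp_neg_mul_lt_one {α : ℂ} (hα : 0 < α.re) {t : ℝ} (ht : 0 < t) :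
    ‖Complex.exp (-α * t)‖ < 1 := by
  rw [Complex.norm_exp, Real.exp_lt_one_iff]
  simpa using mul_pos hα ht

theorem hasSum_barnesKernel {α β : ℂ} (hα : 0 < α.re) (hβ : 0 < β.re) (x y : ℝ) {t : ℝ}
    (ht : 0 < t) :
    HasSum (fun p : ℕ × ℕ => Complex.exp (-((x + p.1) * α + (y + p.2) * β) * t))
      (barnesKernel α β x y t) := by
  have h1 := hasSum_geometric_of_norm_lt_one (norm_exp_neg_mul_lt_one hα ht)
  have h2 := hasSum_geometric_of_norm_lt_one (norm_exp_neg_mul_lt_one hβ ht)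
  have h3 := h1.mul h2 (summable_mul_of_summable_norm
    (summable_geometric_of_lt_one (norm_nonneg _) (norm_exp_neg_mul_lt_one hα ht) |>.congr
      fun n => (norm_pow _ n).symm)
    (summable_geometric_of_lt_one (norm_nonneg _) (norm_exp_neg_mul_lt_one hβ ht) |>.congr
      fun n => (norm_pow _ n).symm))
  rw [barnesKernel, div_eq_mul_inv, mul_inv]
  refine (h3.mul_left (Complex.exp (-(x * α + y * β) * t))).congr_fun fun p => ?_
  rw [← Complex.exp_nat_mul, ← Complex.exp_nat_mul, ← Complex.exp_add, ← Complex.exp_add]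
  congr 1
  ring

/-- The linear form is bounded below by a multiple of `(p + 1) + (q + 1) ≥ ((p + 1)(q + 1))^(1/2)`,
so the double series is dominated by the square of `∑ (n + 1)^(-σ/2)`, and `σ/2 > 1`. -/
theorem summable_barnes {a b x y σ : ℝ} (ha : 0 < a) (hb : 0 < b) (hx : 0 < x) (hy : 0 ≤ y)
    (hσ : 2 < σ) :
    Summable fun p : ℕ × ℕ => ((x + p.1) * a + (y + p.2) * b) ^ (-σ) := by
  -- The condition `2μ ≤ xa` pays for the two units added in `(p + 1) + (q + 1)`.
  obtain ⟨μ, hμ, h1, h2, h3⟩ : ∃ μ : ℝ, 0 < μ ∧ 2 * μ ≤ x * a ∧ μ ≤ a ∧ μ ≤ b :=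
    ⟨min (x * a / 2) (min a b), by positivity, by
      have := min_le_left (x * a / 2) (min a b); linarith,
      (min_le_right _ _).trans (min_le_left _ _), (min_le_right _ _).trans (min_le_right _ _)⟩
  have h4 : Summable fun n : ℕ => ((n : ℝ) + 1) ^ (-(σ / 2)) := by
    have := (summable_nat_add_iff 1).2 (Real.summable_nat_rpow.2 (by linarith : -(σ / 2) < -1))
    simpa using this
  have h5 := (h4.mul_of_nonneg h4 (fun n => by positivity) (fun n => by positivity)).mul_left
    (μ ^ (-σ))
  refine Summable.of_nonneg_of_le (fun p => by positivity) (fun p => ?_) h5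
  have hp : (0 : ℝ) ≤ p.1 := by positivity
  have hq : (0 : ℝ) ≤ p.2 := by positivity
  have h6 : (((p.1 : ℝ) + 1) * (p.2 + 1)) ^ (1 / 2 : ℝ) ≤ ((p.1 : ℝ) + 1) + (p.2 + 1) := by
    rw [← Real.sqrt_eq_rpow]
    refine Real.sqrt_le_iff.2 ⟨by positivity, ?_⟩
    nlinarith
  have h7 : μ * (((p.1 : ℝ) + 1) + (p.2 + 1)) ≤ (x + p.1) * a + (y + p.2) * b := by
    nlinarith [mul_le_mul_of_nonneg_left h2 hp, mul_le_mul_of_nonneg_left h3 hq, mul_nonneg hy hb.le]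
  calc ((x + p.1) * a + (y + p.2) * b) ^ (-σ)
    _ ≤ (μ * (((p.1 : ℝ) + 1) * (p.2 + 1)) ^ (1 / 2 : ℝ)) ^ (-σ) := by
        refine Real.rpow_le_rpow_of_nonpos (by positivity) ?_ (by linarith)
        exact (mul_le_mul_of_nonneg_left h6 hμ.le).trans h7
    _ = _ := by
        rw [Real.mul_rpow hμ.le (by positivity), ← Real.rpow_mul (by positivity),
          Real.mul_rpow (by positivity) (by positivity)]
        ring_nf

theorem hasSum_mellin_barnesKernel {α β : ℂ} (hα : 0 < α.re) (hβ : 0 < β.re) {x y : ℝ}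
    (hx : 0 < x) (hy : 0 ≤ y) {s : ℂ} (hs : 2 < s.re) :
    HasSum (fun p : ℕ × ℕ => Complex.Gamma s * ((x + p.1) * α + (y + p.2) * β : ℂ) ^ (-s))
      (mellin (barnesKernel α β x y) s) := by
  have hre : ∀ p : ℕ × ℕ, ((x + p.1) * α + (y + p.2) * β : ℂ).re =
      (x + p.1) * α.re + (y + p.2) * β.re := fun p => by
    have : ((x + p.1) * α + (y + p.2) * β : ℂ) =
      ((x + p.1 : ℝ) : ℂ) * α + ((y + p.2 : ℝ) : ℂ) * β := by push_cast; ring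
    rw [this, Complex.add_re, Complex.re_ofReal_mul, Complex.re_ofReal_mul]
  refine hasSum_mellin_exp (fun p => ?_) (by linarith)
    (fun t ht => hasSum_barnesKernel hα hβ x y ht) ?_
  · rw [hre]
    positivity
  · simp_rw [hre]
    exact summable_barnes hα hβ hx hy hs

/-! ### Expansion at the origin and continuation to `Re s > -1` -/

open MeasureTheory Set in
/-- The Mellin transform of a function with a polar part of order two at the origin. -/
theorem exists_mellin_eq_add_polar {F : ℝ → ℂ} {δ : ℝ} (hδ : 0 < δ) {c₂ c₁ c₀ : ℂ}
    (hF : ContinuousOn F (Ioi 0)) (htop : F =O[atTop] fun t => Real.exp (-δ * t))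
    (hbot : (fun t : ℝ => F t - (c₂ * (t : ℂ) ^ (-2 : ℂ) + c₁ * (t : ℂ) ^ (-1 : ℂ) + c₀))
      =O[𝓝[>] 0] fun t : ℝ => t) :
    ∃ H : ℂ → ℂ, DifferentiableOn ℂ H {s | -1 < s.re} ∧
      ∀ s : ℂ, 2 < s.re → mellin F s = H s + (c₂ / (s - 2) + c₁ / (s - 1) + c₀ / s) := by
  -- The polar part is cut off to `(0, 1]`: there `t^(-2)`, `t^(-1)` and `1` have Mellin transforms
  -- `1/(s-2)`, `1/(s-1)` and `1/s`, and the decay at infinity is unaffected. What remains is `O(t)`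
  -- at `0`, so its transform is holomorphic for `Re s > -1`.
  set P : ℝ → ℂ := fun t => c₂ • (Ioc (0 : ℝ) 1).indicator (fun t : ℝ => (t : ℂ) ^ (-2 : ℂ)) t +
    c₁ • (Ioc (0 : ℝ) 1).indicator (fun t : ℝ => (t : ℂ) ^ (-1 : ℂ)) t +
    c₀ • (Ioc (0 : ℝ) 1).indicator (fun _ : ℝ => (1 : ℂ)) t with hP
  have hPM : ∀ s : ℂ, 2 < s.re →
      HasMellin P s (c₂ / (s - 2) + c₁ / (s - 1) + c₀ / s) := fun s hs => by
    have m2 := hasMellin_cpow_Ioc (-2) (s := s) (by simp; linarith)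
    have m1 := hasMellin_cpow_Ioc (-1) (s := s) (by simp; linarith)
    have m0 := hasMellin_one_Ioc (s := s) (by linarith)
    have a2 := hasMellin_const_smul m2.1 c₂
    have a1 := hasMellin_const_smul m1.1 c₁
    have a0 := hasMellin_const_smul m0.1 c₀
    have b := hasMellin_add (hasMellin_add a2.1 a1.1).1 a0.1
    refine ⟨b.1, ?_⟩
    rw [hP, b.2, (hasMellin_add a2.1 a1.1).2, a2.2, a1.2, a0.2, m2.2, m1.2, m0.2]
    simp only [smul_eq_mul]
    ring
  have hli : ∀ G : ℝ → ℂ, ContinuousOn G (Ioi 0) →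
      LocallyIntegrableOn ((Ioc (0 : ℝ) 1).indicator G) (Ioi 0) := fun G hG t ht => by
    obtain ⟨U, hU, hU'⟩ := hG.locallyIntegrableOn (μ := volume) measurableSet_Ioi t ht
    exact ⟨U, hU, hU'.indicator measurableSet_Ioc⟩
  have hcp : ∀ a : ℂ, ContinuousOn (fun t : ℝ => (t : ℂ) ^ a) (Ioi 0) := fun a t ht =>
    (Complex.continuousAt_ofReal_cpow_const _ _ (Or.inr (ne_of_gt ht))).continuousWithinAt
  have hFli := hF.locallyIntegrableOn (μ := volume) measurableSet_Ioi
  have hPli : LocallyIntegrableOn P (Ioi 0) :=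
    (((hli _ (hcp _)).smul c₂).add ((hli _ (hcp _)).smul c₁)).add
      ((hli _ continuousOn_const).smul c₀)
  have hPtop : ∀ᶠ t in atTop, P t = 0 := by
    filter_upwards [eventually_gt_atTop (1 : ℝ)] with t ht
    have : t ∉ Ioc (0 : ℝ) 1 := fun h => absurd h.2 (not_le.2 ht)
    simp [hP, indicator_of_notMem this]
  have hPbot : ∀ᶠ t : ℝ in 𝓝[>] 0, P t = c₂ * (t : ℂ) ^ (-2 : ℂ) + c₁ * (t : ℂ) ^ (-1 : ℂ) + c₀ := by
    filter_upwards [Ioc_mem_nhdsGT (zero_lt_one' ℝ)] with t ht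
    simp only [hP, indicator_of_mem ht, smul_eq_mul, mul_one]
  have hsubtop : (fun t => F t - P t) =O[atTop] fun t => Real.exp (-δ * t) :=
    htop.congr' (by filter_upwards [hPtop] with t ht; rw [ht, sub_zero]) EventuallyEq.rfl
  have hsubbot : (fun t => F t - P t) =O[𝓝[>] 0] fun t : ℝ => t ^ (-(-1 : ℝ)) := by
    simp only [neg_neg, Real.rpow_one]
    exact hbot.congr' (by filter_upwards [hPbot] with t ht; rw [ht]) EventuallyEq.rfl
  refine ⟨mellin fun t => F t - P t, fun s hs =>
    (mellin_differentiableAt_of_isBigO_rpow_exp hδ (hFli.sub hPli) hsubtop hsubbot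
      hs).differentiableWithinAt, fun s hs => ?_⟩
  have h1 := mellinConvergent_of_isBigO_rpow_exp hδ (hFli.sub hPli) hsubtop hsubbot
    (by linarith : -1 < s.re)
  have h2 := hasMellin_add h1 (hPM s hs).1
  rw [(hPM s hs).2] at h2
  have h3 : (fun t => (F - P) t + P t) = F := by
    ext t
    simp
  rw [h3] at h2
  exact h2.2

/-- The expansion of `exp (-x u) / (1 - exp (-u))` at the origin. -/
theorem exp_div_one_sub_exp_isBigO (x : ℝ) :
    (fun u : ℂ => Complex.exp (-x * u) / (1 - Complex.exp (-u)) -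
      (u⁻¹ + (-(bernoulliFun 1 x) : ℂ) + (bernoulliFun 2 x / 2 : ℂ) * u)) =O[𝓝[≠] 0]
      fun u => u ^ 2 := by
  set b : ℂ := -(bernoulliFun 1 x) with hb
  set e : ℂ := bernoulliFun 2 x / 2 with he
  have hb' : b = 1 / 2 - x := by rw [hb, bernoulliFun_one]; push_cast; ring
  have he' : e = (x ^ 2 - x + 6⁻¹) / 2 := by rw [he, bernoulliFun_two]; push_cast; ring
  have hinv : (fun u : ℂ => (1 - Complex.exp (-u))⁻¹) =O[𝓝[≠] 0] fun u => u⁻¹ := by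
    have h1 : HasDerivAt (fun u : ℂ => 1 - Complex.exp (-u)) 1 0 := by
      simpa using ((hasDerivAt_neg (0 : ℂ)).cexp).const_sub 1
    have h2 : (fun u : ℂ => u) =O[𝓝 0] fun u => 1 - Complex.exp (-u) := by
      have h3 : Tendsto (fun u : ℂ => (u, (0 : ℂ))) (𝓝 0) (𝓝 0 ×ˢ pure 0) :=
        tendsto_id.prodMk (tendsto_pure.2 (Eventually.of_forall fun _ => rfl))
      refine ((h1.isTheta_sub one_ne_zero).2.comp_tendsto h3).congr (fun u => ?_) (fun u => ?_) <;>
        simp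
    refine (h2.mono nhdsWithin_le_nhds).inv_rev ?_
    filter_upwards with u hu
    simp [hu]
  set R : ℕ → ℂ → ℂ := fun n u => Complex.exp u - ∑ i ∈ Finset.range n, u ^ i / i.factorial with hR
  have hRO : ∀ (n : ℕ) (y : ℂ), (fun u : ℂ => R n (y * u)) =O[𝓝[≠] 0] fun u => u ^ n :=
    fun n y => by
      have h1 : Tendsto (fun u : ℂ => y * u) (𝓝[≠] 0) (𝓝 0) :=
        (Continuous.tendsto' (by fun_prop) _ _ (by simp)).mono_left nhdsWithin_le_nhds
      have h2 := (Complex.exp_sub_sum_range_isBigO_pow n).comp_tendsto h1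
      refine h2.trans (Asymptotics.IsBigO.of_bound (‖y‖ ^ n) (Eventually.of_forall fun u => ?_))
      simp [mul_pow]
  have hpow : ∀ {m n : ℕ}, n ≤ m → (fun u : ℂ => u ^ m) =O[𝓝[≠] 0] fun u => u ^ n :=
    fun {m n} h => Asymptotics.IsBigO.of_bound 1 (by
      filter_upwards [nhdsWithin_le_nhds (Metric.ball_mem_nhds (0 : ℂ) one_pos)] with u hu
      rw [one_mul, norm_pow, norm_pow]
      exact pow_le_pow_of_le_one (norm_nonneg _) (mem_ball_zero_iff.1 hu).le h)
  -- The quotient estimate is cleared of its denominator: `1 - exp(-u)` is comparable to `u`, so an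
  -- error `O(u³)` in the numerator is what is needed. The factor `u⁻¹` forces expanding `exp(-u)`
  -- one order further than `exp(-xu)`.
  have hnum : (fun u : ℂ => Complex.exp (-x * u) -
      (1 - Complex.exp (-u)) * (u⁻¹ + b + e * u)) =O[𝓝[≠] 0] fun u => u ^ 3 := by
    have h1 := hRO 3 (-x)
    have h2 : (fun u : ℂ => R 4 (-1 * u) * (u⁻¹ + b + e * u)) =O[𝓝[≠] 0] fun u => u ^ 3 := by
      have h3 : (fun u : ℂ => u⁻¹ + b + e * u) =O[𝓝[≠] 0] fun u => u⁻¹ := by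
        refine ((Asymptotics.isBigO_refl _ _).add ?_).add ?_
        · refine (Asymptotics.IsBigO.of_bound ‖b‖ ?_)
          filter_upwards [nhdsWithin_le_nhds (Metric.ball_mem_nhds (0 : ℂ) one_pos),
            self_mem_nhdsWithin] with u hu hu0
          have h4 : ‖u‖ ≤ 1 := (mem_ball_zero_iff.1 hu).le
          rw [norm_inv]
          exact le_mul_of_one_le_right (norm_nonneg _)
            ((one_le_inv₀ (norm_pos_iff.2 hu0)).2 h4)
        · refine (Asymptotics.IsBigO.of_bound ‖e‖ ?_)
          filter_upwards [nhdsWithin_le_nhds (Metric.ball_mem_nhds (0 : ℂ) one_pos),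
            self_mem_nhdsWithin] with u hu hu0
          have h4 : ‖u‖ ≤ 1 := (mem_ball_zero_iff.1 hu).le
          rw [norm_inv, norm_mul]
          exact mul_le_mul_of_nonneg_left
            (h4.trans ((one_le_inv₀ (norm_pos_iff.2 hu0)).2 h4)) (norm_nonneg _)
      refine ((hRO 4 (-1)).mul h3).congr' EventuallyEq.rfl ?_
      filter_upwards [self_mem_nhdsWithin] with u hu
      have : u ≠ 0 := hu
      field_simp
    have h4 : (fun u : ℂ => (e / 2 - b / 6) * u ^ 3) =O[𝓝[≠] 0] fun u => u ^ 3 :=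
      (Asymptotics.isBigO_refl _ _).const_mul_left _
    have h5 : (fun u : ℂ => (-(e / 6)) * u ^ 4) =O[𝓝[≠] 0] fun u => u ^ 3 :=
      (hpow (by norm_num)).const_mul_left _
    refine (((h1.add h2).add h4).add h5).congr' ?_ EventuallyEq.rfl
    filter_upwards [self_mem_nhdsWithin] with u hu
    have hu' : u ≠ 0 := hu
    simp only [hR, Finset.sum_range_succ, Finset.sum_range_zero, Nat.factorial, neg_one_mul]
    rw [hb', he']
    field_simp
    push_cast
    ring
  refine (hnum.mul hinv).congr' ?_ ?_
  · filter_upwards [self_mem_nhdsWithin, nhdsWithin_le_nhds (Metric.ball_mem_nhds (0 : ℂ)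
      Real.two_pi_pos)] with u hu hu2
    have h1 : 1 - Complex.exp (-u) ≠ 0 := by
      intro h
      rw [sub_eq_zero, eq_comm, Complex.exp_eq_one_iff] at h
      obtain ⟨n, hn⟩ := h
      have h3 : ‖u‖ = |(n : ℝ)| * (2 * Real.pi) := by
        rw [← norm_neg, hn]
        simp [abs_of_pos Real.pi_pos]
      have h4 : ‖u‖ < 2 * Real.pi := mem_ball_zero_iff.1 hu2
      have h5 : n = 0 := by
        by_contra h5
        have h6 : (1 : ℝ) ≤ |(n : ℝ)| := by exact_mod_cast Int.one_le_abs h5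
        nlinarith [Real.pi_pos]
      rw [h5] at hn
      simp at hn
      exact hu hn
    field_simp
  · filter_upwards [self_mem_nhdsWithin] with u hu
    have : u ≠ 0 := hu
    field_simp

theorem barnesKernel_eq (α β : ℂ) (x y t : ℝ) : barnesKernel α β x y t =
    (Complex.exp (-x * (α * t)) / (1 - Complex.exp (-(α * t)))) *
      (Complex.exp (-y * (β * t)) / (1 - Complex.exp (-(β * t)))) := by
  rw [barnesKernel, div_mul_div_comm, ← Complex.exp_add]
  ring_nf

theorem one_sub_exp_ne_zero {α : ℂ} (hα : 0 < α.re) {t : ℝ} (ht : 0 < t) :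
    1 - Complex.exp (-α * t) ≠ 0 := by
  intro h
  have h1 := norm_exp_neg_mul_lt_one hα ht
  rw [← sub_eq_zero.1 h, norm_one] at h1
  exact lt_irrefl _ h1

theorem continuousOn_barnesKernel {α β : ℂ} (hα : 0 < α.re) (hβ : 0 < β.re) (x y : ℝ) :
    ContinuousOn (barnesKernel α β x y) (Set.Ioi 0) := by
  refine ContinuousOn.div (by fun_prop) (by fun_prop) fun t ht => ?_
  exact mul_ne_zero (one_sub_exp_ne_zero hα ht) (one_sub_exp_ne_zero hβ ht)

theorem barnesKernel_isBigO_atTop {α β : ℂ} (hα : 0 < α.re) (hβ : 0 < β.re) (x y : ℝ) :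
    barnesKernel α β x y =O[atTop] fun t => Real.exp (-(x * α.re + y * β.re) * t) := by
  have h0 : ∀ γ : ℂ, 0 < γ.re →
      Tendsto (fun t : ℝ => 1 - Complex.exp (-γ * t)) atTop (𝓝 1) := fun γ hγ => by
    have h1 : Tendsto (fun t : ℝ => Complex.exp (-γ * t)) atTop (𝓝 0) := by
      rw [tendsto_zero_iff_norm_tendsto_zero]
      simp only [Complex.norm_exp]
      refine Real.tendsto_exp_atBot.comp ?_
      have : ∀ t : ℝ, (-γ * t).re = -γ.re * t := fun t => by simp
      simp_rw [this]
      exact tendsto_id.const_mul_atTop_of_neg (by linarith)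
    simpa using h1.const_sub 1
  have h1 : Tendsto (fun t : ℝ => ((1 - Complex.exp (-α * t)) * (1 - Complex.exp (-β * t)))⁻¹)
      atTop (𝓝 1) := by
    simpa using ((h0 α hα).mul (h0 β hβ)).inv₀ (by simp)
  have h2 : (fun t : ℝ => Complex.exp (-(x * α + y * β) * t)) =O[atTop]
      fun t => Real.exp (-(x * α.re + y * β.re) * t) := by
    refine Asymptotics.IsBigO.of_bound 1 (Eventually.of_forall fun t => ?_)
    rw [Complex.norm_exp, Real.norm_eq_abs, Real.abs_exp, one_mul]
    simp
  simpa only [mul_one, div_eq_mul_inv] using! h2.mul (h1.isBigO_one ℝ)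

theorem barnesKernel_isBigO_zero {α β : ℂ} (hα : α ≠ 0) (hβ : β ≠ 0) (x y : ℝ) :
    (fun t : ℝ => barnesKernel α β x y t - ((α * β)⁻¹ * (t : ℂ) ^ (-2 : ℂ) +
        (-(bernoulliFun 1 y / α + bernoulliFun 1 x / β)) * (t : ℂ) ^ (-1 : ℂ) +
        (bernoulliFun 1 x * bernoulliFun 1 y + bernoulliFun 2 x / 2 * (α / β) +
          bernoulliFun 2 y / 2 * (β / α)))) =O[𝓝[>] 0] fun t : ℝ => t := by
  have hlin : ∀ γ : ℂ, γ ≠ 0 → Tendsto (fun t : ℝ => γ * t) (𝓝[>] 0) (𝓝[≠] 0) := fun γ hγ => by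
    refine tendsto_nhdsWithin_of_tendsto_nhds_of_eventually_within _
      ((Continuous.tendsto' (by fun_prop) _ _ (by simp)).mono_left nhdsWithin_le_nhds) ?_
    filter_upwards [self_mem_nhdsWithin] with t ht
    have : t ≠ 0 := ne_of_gt ht
    simp [hγ, this]
  have hsq : ∀ γ : ℂ, (fun t : ℝ => (γ * t) ^ 2) =O[𝓝[>] 0] fun t : ℝ => t ^ 2 := fun γ => by
    refine Asymptotics.IsBigO.of_bound (‖γ‖ ^ 2) (Eventually.of_forall fun t => ?_)
    simp [mul_pow]
  have hle : ∀ᶠ t : ℝ in 𝓝[>] 0, 0 < t ∧ t ≤ 1 := by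
    filter_upwards [Ioc_mem_nhdsGT (zero_lt_one' ℝ)] with t ht using ht
  set A : ℂ → ℝ → ℝ → ℂ := fun γ x t =>
    ((γ * t)⁻¹ + (-(bernoulliFun 1 x) : ℂ) + (bernoulliFun 2 x / 2 : ℂ) * (γ * t)) with hA
  set E : ℂ → ℝ → ℝ → ℂ := fun γ x t =>
    Complex.exp (-x * (γ * t)) / (1 - Complex.exp (-(γ * t))) - A γ x t with hE
  have hEO : ∀ γ : ℂ, γ ≠ 0 → ∀ x, E γ x =O[𝓝[>] 0] fun t : ℝ => t ^ 2 := fun γ hγ x =>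
    ((exp_div_one_sub_exp_isBigO x).comp_tendsto (hlin γ hγ)).trans (hsq γ)
  have hconst : ∀ C : ℂ, (fun _ : ℝ => C) =O[𝓝[>] 0] fun t : ℝ => t⁻¹ := fun C => by
    refine Asymptotics.IsBigO.of_bound ‖C‖ ?_
    filter_upwards [hle] with t ht
    rw [norm_inv, Real.norm_of_nonneg ht.1.le]
    exact le_mul_of_one_le_right (norm_nonneg _) ((one_le_inv₀ ht.1).2 ht.2)
  have hAO : ∀ γ : ℂ, ∀ x, A γ x =O[𝓝[>] 0] fun t : ℝ => t⁻¹ := fun γ x => by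
    refine (Asymptotics.IsBigO.add ?_ (hconst _)).add ?_
    · refine Asymptotics.IsBigO.of_bound ‖γ⁻¹‖ (Eventually.of_forall fun t => ?_)
      simp [mul_comm]
    · refine Asymptotics.IsBigO.of_bound ‖(bernoulliFun 2 x / 2 : ℂ) * γ‖ ?_
      filter_upwards [hle] with t ht
      rw [← mul_assoc, norm_mul, norm_inv, Complex.norm_real, Real.norm_of_nonneg ht.1.le]
      exact mul_le_mul_of_nonneg_left (ht.2.trans ((one_le_inv₀ ht.1).2 ht.2)) (norm_nonneg _)
  have hmix : (fun t : ℝ => t⁻¹ * t ^ 2) =ᶠ[𝓝[>] 0] fun t => t := by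
    filter_upwards [hle] with t ht
    have := ht.1.ne'
    field_simp
  -- Each factor of the kernel is `A + E` with `A = O(1/t)` and `E = O(t²)`, so every product
  -- involving an `E` is `O(t)`. In `A·A` the terms of degree `1` and `2` are absorbed by `h4`.
  have h1 : (fun t => A α x t * E β y t) =O[𝓝[>] 0] fun t : ℝ => t :=
    ((hAO α x).mul (hEO β hβ y)).congr' EventuallyEq.rfl hmix
  have h2 : (fun t => A β y t * E α x t) =O[𝓝[>] 0] fun t : ℝ => t :=
    ((hAO β y).mul (hEO α hα x)).congr' EventuallyEq.rfl hmix
  have hpow : ∀ n : ℕ, 1 ≤ n → (fun t : ℝ => t ^ n) =O[𝓝[>] 0] fun t : ℝ => t := fun n hn => by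
    refine Asymptotics.IsBigO.of_bound 1 ?_
    filter_upwards [hle] with t ht
    rw [one_mul, norm_pow, Real.norm_of_nonneg ht.1.le]
    exact pow_le_of_le_one ht.1.le ht.2 (by omega)
  have h3 : (fun t => E α x t * E β y t) =O[𝓝[>] 0] fun t : ℝ => t :=
    ((hEO α hα x).mul (hEO β hβ y)).trans
      ((hpow 4 (by norm_num)).congr_left fun t => by ring)
  have h4 : ∀ (C : ℂ) (n : ℕ), 1 ≤ n →
      (fun t : ℝ => C * ((t ^ n : ℝ) : ℂ)) =O[𝓝[>] 0] fun t : ℝ => t := fun C n hn =>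
    (Asymptotics.IsBigO.const_mul_left (Complex.isBigO_ofReal_left.2 (hpow n hn)) C)
  refine ((((h1.add h2).add h3).add (h4 (-(bernoulliFun 1 x * (bernoulliFun 2 y / 2) * β +
    bernoulliFun 1 y * (bernoulliFun 2 x / 2) * α)) 1 le_rfl)).add
    (h4 (bernoulliFun 2 x / 2 * (bernoulliFun 2 y / 2) * α * β) 2 (by norm_num))).congr' ?_
    EventuallyEq.rfl
  filter_upwards [hle] with t ht
  have ht' : (t : ℂ) ≠ 0 := by exact_mod_cast ht.1.ne'
  have e2 : (t : ℂ) ^ (-2 : ℂ) = ((t : ℂ) ^ 2)⁻¹ := by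
    rw [Complex.cpow_neg]
    norm_cast
  rw [barnesKernel_eq, Complex.cpow_neg_one, e2]
  have e3 : ∀ (γ : ℂ) (x : ℝ), Complex.exp (-x * (γ * t)) / (1 - Complex.exp (-(γ * t))) = A γ x t + E γ x t :=
    fun γ x => by simp [hE]
  rw [e3, e3]
  have e4 : A α x t * A β y t = ((α * β)⁻¹ * ((t : ℂ) ^ 2)⁻¹ +
      (-(bernoulliFun 1 y / α + bernoulliFun 1 x / β)) * (t : ℂ)⁻¹ +
        (bernoulliFun 1 x * bernoulliFun 1 y + bernoulliFun 2 x / 2 * (α / β) +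
          bernoulliFun 2 y / 2 * (β / α))) + (-(bernoulliFun 1 x * (bernoulliFun 2 y / 2) * β +
      bernoulliFun 1 y * (bernoulliFun 2 x / 2) * α) * ((t ^ 1 : ℝ) : ℂ) +
      bernoulliFun 2 x / 2 * (bernoulliFun 2 y / 2) * α * β * ((t ^ 2 : ℝ) : ℂ)) := by
    simp only [hA]
    generalize (bernoulliFun 1 x : ℂ) = X1
    generalize (bernoulliFun 1 y : ℂ) = Y1
    generalize (bernoulliFun 2 x : ℂ) = X2
    generalize (bernoulliFun 2 y : ℂ) = Y2
    push_cast
    field_simp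
    ring
  linear_combination -e4

/-- The continuation of the double zeta function, multiplied by `Γ`, to `-1 < Re s`. -/
theorem exists_mellin_barnesKernel {α β : ℂ} (hα : 0 < α.re) (hβ : 0 < β.re) {x y : ℝ}
    (hx : 0 < x) (hy : 0 ≤ y) :
    ∃ H : ℂ → ℂ, DifferentiableOn ℂ H {s | -1 < s.re} ∧
      ∀ s : ℂ, 2 < s.re → mellin (barnesKernel α β x y) s = H s + ((α * β)⁻¹ / (s - 2) +
        (-(bernoulliFun 1 y / α + bernoulliFun 1 x / β)) / (s - 1) +
        (bernoulliFun 1 x * bernoulliFun 1 y + bernoulliFun 2 x / 2 * (α / β) +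
          bernoulliFun 2 y / 2 * (β / α)) / s) := by
  have hα0 : α ≠ 0 := by rintro rfl; simp at hα
  have hβ0 : β ≠ 0 := by rintro rfl; simp at hβ
  exact exists_mellin_eq_add_polar (δ := x * α.re + y * β.re) (by positivity)
    (continuousOn_barnesKernel hα hβ x y) (barnesKernel_isBigO_atTop hα hβ x y)
    (barnesKernel_isBigO_zero hα0 hβ0 x y)

/-! ### Decomposition of the cone modulo its two periods -/

/-- Representatives of the lattice points of the cone modulo its two periods. -/
noncomputable def coneBox (k : ℕ) (c : ℤ) : Finset (ℤ × ℤ) :=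
  Finset.Ico 0 (c * k) ×ˢ Finset.Ioc 0 (k : ℤ)

/-- The second coordinate of a representative. -/
def coneShift (c d : ℤ) (i : ℤ × ℤ) : ℤ := i.2 + d * i.1 / c

/-- The translates of the representatives by the two periods of the cone. -/
def coneMap (k : ℕ) (c d : ℤ) (q : coneBox k c × (ℕ × ℕ)) : ℤ × ℤ :=
  (q.1.1.1 + c * k * q.2.2, coneShift c d q.1.1 + k * q.2.1 + d * k * q.2.2)

theorem eq_of_add_mul_eq {m a a' : ℤ} {q q' : ℕ} (h0 : 0 ≤ a) (h1 : a < m) (h0' : 0 ≤ a')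
    (h1' : a' < m) (h : a + m * q = a' + m * q') : a = a' ∧ q = q' := by
  have h2 : a = a' := by
    have h3 := congrArg (· % m) h
    simpa only [Int.add_mul_emod_self_left, Int.emod_eq_of_lt h0 h1, Int.emod_eq_of_lt h0' h1']
      using h3
  refine ⟨h2, ?_⟩
  subst h2
  have h3 : m * (q : ℤ) = m * q' := by linarith
  have h4 := mul_left_cancel₀ (by linarith : m ≠ 0) h3
  exact_mod_cast h4

theorem coneMap_injective {k : ℕ} (c d : ℤ) : Function.Injective (coneMap k c d) := by
  rintro ⟨⟨⟨M, j⟩, hi⟩, p, q⟩ ⟨⟨⟨M', j'⟩, hi'⟩, p', q'⟩ h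
  simp only [coneBox, Finset.mem_product, Finset.mem_Ico, Finset.mem_Ioc] at hi hi'
  simp only [coneMap, coneShift, Prod.mk.injEq] at h
  obtain ⟨rfl, rfl⟩ := eq_of_add_mul_eq hi.1.1 hi.1.2 hi'.1.1 hi'.1.2 h.1
  -- The residue `j` runs over `(0, k]`, so uniqueness of division is applied to `j - 1`.
  obtain ⟨h1, rfl⟩ := eq_of_add_mul_eq (m := k) (a := j - 1) (a' := j' - 1) (q := p) (q' := p')
    (by omega) (by omega) (by omega) (by omega) (by linarith [h.2])
  obtain rfl : j = j' := by omega
  rfl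

theorem coneMap_mem {k : ℕ} {c : ℤ} (hc : 0 < c) (d : ℤ) (q : coneBox k c × (ℕ × ℕ)) :
    0 ≤ (coneMap k c d q).1 ∧ (coneMap k c d q).1 * d < (coneMap k c d q).2 * c := by
  obtain ⟨⟨⟨M, j⟩, hi⟩, p, q⟩ := q
  simp only [coneBox, Finset.mem_product, Finset.mem_Ico, Finset.mem_Ioc] at hi
  simp only [coneMap, coneShift]
  refine ⟨by have := hi.1.1; positivity, ?_⟩
  have h1 := Int.lt_ediv_add_one_mul_self (d * M) hc
  have h2 : (0 : ℤ) ≤ k * p * c := by positivity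
  nlinarith [hi.2.1]

theorem exists_coneMap_eq {k : ℕ} (hk : 0 < k) {c : ℤ} (hc : 0 < c) (d : ℤ) {p : ℤ × ℤ}
    (h : 0 ≤ p.1 ∧ p.1 * d < p.2 * c) : ∃ q, coneMap k c d q = p := by
  obtain ⟨M, N⟩ := p
  simp only at h
  have hk' : (0 : ℤ) < k := by exact_mod_cast hk
  have hck : 0 < c * k := mul_pos hc hk'
  set q := M / (c * k) with hq
  set M0 := M % (c * k) with hM0
  have hM : M0 + c * k * q = M := Int.emod_add_mul_ediv M (c * k)
  have hq0 : 0 ≤ q := Int.ediv_nonneg h.1 hck.le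
  -- After removing `q` periods `k(cz + d)`, the cone condition says that the second coordinate
  -- exceeds `⌊d M0 / c⌋`. The excess, minus one, is then divided by `k`.
  set r := N - d * k * q - d * M0 / c - 1 with hr
  have hr0 : 0 ≤ r := by
    have h1 : d * M0 / c < N - d * k * q := by
      rw [Int.ediv_lt_iff_lt_mul hc]
      have h2 := h.2
      rw [← hM] at h2
      linarith
    omega
  have hr1 : r % k + k * (r / k) = r := Int.emod_add_mul_ediv r k
  have hp0 : 0 ≤ r / k := Int.ediv_nonneg hr0 hk'.le
  refine ⟨(⟨(M0, r % k + 1), ?_⟩, (r / k).toNat, q.toNat), ?_⟩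
  · simp only [coneBox, Finset.mem_product, Finset.mem_Ico, Finset.mem_Ioc]
    have := Int.emod_nonneg r hk'.ne'
    have := Int.emod_lt_of_pos r hk'
    exact ⟨⟨Int.emod_nonneg _ hck.ne', Int.emod_lt_of_pos _ hck⟩, by omega, by omega⟩
  · simp only [coneMap, coneShift, Int.toNat_of_nonneg hp0, Int.toNat_of_nonneg hq0, Prod.mk.injEq]
    refine ⟨hM, ?_⟩
    linarith

/-- The rotation by `-φ` leaves the argument in `(-π, π)`, so the principal logarithm changes by
exactly `-φ i`. -/
theorem cpow_eq_exp_mul_cpow {w : ℂ} (hw : IsUpper w) {φ : ℝ} (h0 : 0 ≤ φ) (h1 : φ < Real.pi)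
    (s : ℂ) : w ^ s = Complex.exp (φ * Complex.I * s) *
      (Complex.exp (-(φ * Complex.I)) * w) ^ s := by
  have h2 : Complex.log (Complex.exp (-(φ * Complex.I)) * w) = Complex.log w - φ * Complex.I := by
    conv_lhs => rw [← Complex.exp_log hw.ne_zero, ← Complex.exp_add]
    rw [Complex.log_exp]
    · ring
    · have := hw.arg_nonneg
      simp [Complex.log_im]
      linarith
    · have := hw.arg_lt
      simp [Complex.log_im]
      linarith
  rw [Complex.cpow_def_of_ne_zero hw.ne_zero, Complex.cpow_def_of_ne_zero
    (mul_ne_zero (Complex.exp_ne_zero _) hw.ne_zero), h2, ← Complex.exp_add]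
  ring_nf

theorem periodic_neg_add_mul {k : ℕ} {u : ℤ → ℂ} (hu : Function.Periodic u (k : ℤ)) (m q : ℤ) :
    u (-(m + k * q)) = u (-m) := by
  have := hu.int_mul (-q) (-m)
  rw [← this]
  congr 1
  simp
  ring

/-- Half of the argument of `c z + d`. -/
noncomputable def halfArg (c d : ℤ) (z : ℂ) : ℝ := (c * z + d : ℂ).arg / 2

/-- The first coordinate, with respect to `k` and `k (c z + d)`, of a representative. -/
noncomputable def coneX (k : ℕ) (c d : ℤ) (i : ℤ × ℤ) : ℝ :=
  (coneShift c d i - d * i.1 / c) / k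

/-- The second coordinate, with respect to `k` and `k (c z + d)`, of a representative. -/
noncomputable def coneY (k : ℕ) (c : ℤ) (i : ℤ × ℤ) : ℝ := i.1 / (c * k)

theorem coneX_pos {k : ℕ} (hk : 0 < k) {c : ℤ} (hc : 0 < c) (d : ℤ) {i : ℤ × ℤ}
    (hi : i ∈ coneBox k c) : 0 < coneX k c d i := by
  simp only [coneBox, Finset.mem_product, Finset.mem_Ico, Finset.mem_Ioc] at hi
  have hc' : (0 : ℝ) < c := by exact_mod_cast hc
  have hk' : (0 : ℝ) < k := by exact_mod_cast hk
  rw [coneX]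
  refine div_pos ?_ hk'
  rw [sub_pos, div_lt_iff₀ hc']
  have h1 := Int.lt_ediv_add_one_mul_self (d * i.1) hc
  have h2 : d * i.1 < coneShift c d i * c := by
    rw [coneShift]
    nlinarith [hi.2.1]
  exact_mod_cast h2

theorem coneX_le_one {k : ℕ} (hk : 0 < k) {c : ℤ} (hc : 0 < c) (d : ℤ) {i : ℤ × ℤ}
    (hi : i ∈ coneBox k c) : coneX k c d i ≤ 1 := by
  simp only [coneBox, Finset.mem_product, Finset.mem_Ico, Finset.mem_Ioc] at hi
  have hc' : (0 : ℝ) < c := by exact_mod_cast hc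
  have hk' : (0 : ℝ) < k := by exact_mod_cast hk
  rw [coneX, div_le_one hk', sub_le_iff_le_add, ← sub_le_iff_le_add', le_div_iff₀ hc']
  have h1 := Int.ediv_mul_le (d * i.1) hc.ne'
  have h2 : (coneShift c d i - k) * c ≤ d * i.1 := by
    rw [coneShift]
    nlinarith [hi.2.2]
  exact_mod_cast h2

theorem coneMap_linear {k : ℕ} (hk : 0 < k) {c : ℤ} (hc : 0 < c) (d : ℤ) (z l : ℂ)
    (q : coneBox k c × (ℕ × ℕ)) :
    l * (((coneMap k c d q).1 : ℂ) * z + (coneMap k c d q).2) =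
      (coneX k c d q.1.1 + q.2.1) * (k * l) + (coneY k c q.1.1 + q.2.2) * (k * l * (c * z + d)) := by
  have hc' : (c : ℂ) ≠ 0 := by exact_mod_cast hc.ne'
  have hk' : (k : ℂ) ≠ 0 := by exact_mod_cast hk.ne'
  simp only [coneMap, coneX, coneY]
  push_cast
  field_simp
  ring

theorem halfArg_bounds {c d : ℤ} (hc : 0 < c) {z : ℂ} (hz : 0 < z.im) :
    0 ≤ halfArg c d z ∧ halfArg c d z < Real.pi / 2 := by
  have h : IsUpper (c * z + d) := Or.inl (linear_im_pos hc hz)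
  rw [halfArg]
  constructor <;> linarith [h.arg_nonneg, h.arg_lt]

/-- A rotation by half the argument of `cz + d` sends the two periods to arguments `-φ` and `φ` with
`0 ≤ φ < π/2`, hence into the right half-plane, where the Mellin integrals converge. -/
theorem period_re_pos {k : ℕ} (hk : 0 < k) {c d : ℤ} (hc : 0 < c) {z : ℂ} (hz : 0 < z.im) :
    0 < (k * Complex.exp (-(halfArg c d z * Complex.I))).re ∧
      0 < (k * Complex.exp (-(halfArg c d z * Complex.I)) * (c * z + d)).re := by
  have hb := halfArg_bounds (d := d) hc hz
  have hcos : 0 < Real.cos (halfArg c d z) :=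
    Real.cos_pos_of_mem_Ioo ⟨by linarith, hb.2⟩
  have hτ : (c * z + d : ℂ) ≠ 0 := IsUpper.ne_zero (Or.inl (linear_im_pos hc hz))
  have hk' : (0 : ℝ) < k := by exact_mod_cast hk
  constructor
  · rw [← Complex.ofReal_natCast, Complex.re_ofReal_mul, ← neg_mul, ← Complex.ofReal_neg,
      Complex.exp_ofReal_mul_I_re, Real.cos_neg]
    positivity
  · have h1 : (k * Complex.exp (-(halfArg c d z * Complex.I)) * (c * z + d)) =
        ((k * ‖(c * z + d : ℂ)‖ : ℝ) : ℂ) * Complex.exp (halfArg c d z * Complex.I) := by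
      conv_lhs => rw [← Complex.norm_mul_exp_arg_mul_I (c * z + d)]
      have h2 : ((c * z + d : ℂ).arg : ℂ) * Complex.I =
          halfArg c d z * Complex.I + halfArg c d z * Complex.I := by
        rw [halfArg]; push_cast; ring
      rw [h2, Complex.exp_add, Complex.exp_neg]
      push_cast
      field_simp [Complex.exp_ne_zero]
    rw [h1, Complex.re_ofReal_mul, Complex.exp_ofReal_mul_I_re]
    have := norm_pos_iff.2 hτ
    positivity

/-- Periodicity makes the coefficients constant on each class modulo the periods, and on one class
the linear form is `(x + p)α + (y + q)β` after the rotation. The rotation costs a factor that tends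
to `1` as `s → 0`. -/
theorem gamma_mul_tsum_coneTerm {k : ℕ} (hk : 0 < k) {u v : ℤ → ℂ}
    (hu : Function.Periodic u (k : ℤ)) (hv : Function.Periodic v (k : ℤ)) {c d : ℤ} (hc : 0 < c)
    {z : ℂ} (hz : 0 < z.im) {s : ℂ} (hs : 2 < s.re) :
    Complex.Gamma s * ∑' p, coneTerm u v c d z s p =
      Complex.exp (-(halfArg c d z * Complex.I * s)) *
        ∑ i ∈ coneBox k c, u (-i.1) * v (-coneShift c d i) *
          mellin (barnesKernel (k * Complex.exp (-(halfArg c d z * Complex.I)))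
            (k * Complex.exp (-(halfArg c d z * Complex.I)) * (c * z + d))
            (coneX k c d i) (coneY k c i)) s := by
  have hsum := summable_coneTerm (d := d) hk hu hv hc hz hs
  have hb := halfArg_bounds (d := d) hc hz
  have hre := period_re_pos hk (d := d) hc hz
  set l := Complex.exp (-(halfArg c d z * Complex.I)) with hl
  have hsupp : Function.support (coneTerm u v c d z s) ⊆ Set.range (coneMap k c d) := by
    intro p hp
    by_contra h
    refine hp (if_neg fun hcone => h ?_)
    exact exists_coneMap_eq hk hc d hcone
  rw [← (coneMap_injective c d).tsum_eq hsupp]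
  have hsum' := hsum.comp_injective (coneMap_injective (k := k) c d)
  have h1 := hsum'.tsum_prod
  simp only [Function.comp] at h1
  rw [h1, tsum_fintype, Finset.mul_sum, Finset.mul_sum, ← Finset.sum_coe_sort (coneBox k c)]
  refine Finset.sum_congr rfl fun i _ => ?_
  have hbar := hasSum_mellin_barnesKernel hre.1 hre.2 (coneX_pos hk hc d i.2)
    (y := coneY k c i) (by
      have h2 := i.2
      simp only [coneBox, Finset.mem_product, Finset.mem_Ico, Finset.mem_Ioc] at h2
      have h3 : (0 : ℝ) ≤ (i : ℤ × ℤ).1 := by exact_mod_cast h2.1.1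
      have h4 : (0 : ℝ) < c := by exact_mod_cast hc
      rw [coneY]
      positivity) hs
  rw [← hbar.tsum_eq, ← tsum_mul_left, ← tsum_mul_left, ← tsum_mul_left]
  refine tsum_congr fun p => ?_
  have hm := coneMap_mem (k := k) hc d (i, p)
  rw [coneTerm, if_pos hm, cpow_eq_exp_mul_cpow (isUpper_of_mem_cone hc hz hm) hb.1
    (by linarith [Real.pi_pos]) (-s), ← hl, coneMap_linear hk hc d z l]
  have e1 : u (-(coneMap k c d (i, p)).1) = u (-(i : ℤ × ℤ).1) := by
    rw [← periodic_neg_add_mul hu (i : ℤ × ℤ).1 (c * p.2)]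
    congr 2
    simp only [coneMap]
    ring
  have e2 : v (-(coneMap k c d (i, p)).2) = v (-coneShift c d i) := by
    rw [← periodic_neg_add_mul hv (coneShift c d i) (p.1 + d * p.2)]
    congr 2
    simp only [coneMap]
    ring
  rw [e1, e2, mul_neg]
  ring

/-! ### Passage to the limit at `s = 0` -/

/-- This is the identity theorem on the part of `Re s > -1` formed by the upper and lower quadrants
and the strips `-1 < Re s < 0` and `0 < Re s < 1`. Their union is connected, avoids the possible
poles `0, 1, 2`, and contains a punctured disc about `0`. -/
theorem eventuallyEq_of_eq_of_two_lt_re {L R : ℂ → ℂ}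
    (hL : ∀ s : ℂ, -1 < s.re → s ≠ 0 → s ≠ 1 → s ≠ 2 → DifferentiableAt ℂ L s)
    (hR : ∀ s : ℂ, -1 < s.re → s ≠ 0 → s ≠ 1 → s ≠ 2 → DifferentiableAt ℂ R s)
    (h : ∀ s : ℂ, 2 < s.re → L s = R s) : ∀ᶠ s in 𝓝[≠] (0 : ℂ), L s = R s := by
  set U : Set ℂ := {s | -1 < s.re} ∩ {s | 0 < s.im} with hU
  set V : Set ℂ := {s | -1 < s.re} ∩ {s | s.im < 0} with hV
  set S : Set ℂ := {s | -1 < s.re} ∩ {s | s.re < 0} with hS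
  set T : Set ℂ := {s | 0 < s.re} ∩ {s | s.re < 1} with hT
  have cU : Convex ℝ U := (convex_halfSpace_re_gt _).inter (convex_halfSpace_im_gt _)
  have cV : Convex ℝ V := (convex_halfSpace_re_gt _).inter (convex_halfSpace_im_lt _)
  have cS : Convex ℝ S := (convex_halfSpace_re_gt _).inter (convex_halfSpace_re_lt _)
  have cT : Convex ℝ T := (convex_halfSpace_re_gt _).inter (convex_halfSpace_re_lt _)
  have o1 : ∀ a : ℝ, IsOpen {s : ℂ | a < s.re} := fun a =>
    isOpen_lt continuous_const Complex.continuous_re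
  have o2 : ∀ a : ℝ, IsOpen {s : ℂ | s.re < a} := fun a =>
    isOpen_lt Complex.continuous_re continuous_const
  have o3 : IsOpen {s : ℂ | 0 < s.im} := isOpen_lt continuous_const Complex.continuous_im
  have o4 : IsOpen {s : ℂ | s.im < 0} := isOpen_lt Complex.continuous_im continuous_const
  have hopen : IsOpen (((U ∪ S) ∪ V) ∪ T) :=
    ((((o1 _).inter o3).union ((o1 _).inter (o2 _))).union ((o1 _).inter o4)).union
      ((o1 _).inter (o2 _))
  have hconn : IsPreconnected (((U ∪ S) ∪ V) ∪ T) := by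
    refine IsPreconnected.union (1 / 2 + Complex.I) ?_ ?_ (IsPreconnected.union
      (-1 / 2 - Complex.I) ?_ ?_ (IsPreconnected.union (-1 / 2 + Complex.I) ?_ ?_
        cU.isPreconnected cS.isPreconnected) cV.isPreconnected) cT.isPreconnected
    · left; left; constructor <;> simp; norm_num
    · constructor <;> simp; norm_num
    · right; constructor <;> simp <;> norm_num
    · constructor <;> simp; norm_num
    · constructor <;> simp; norm_num
    · constructor <;> simp <;> norm_num
  have hmem : ∀ s ∈ ((U ∪ S) ∪ V) ∪ T, -1 < s.re ∧ s ≠ 0 ∧ s ≠ 1 ∧ s ≠ 2 := by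
    intro s hs
    have aux : ∀ x : ℝ, (s.im ≠ 0 ∨ s.re ≠ x) → s ≠ x := by
      rintro x (hx | hx) rfl <;> simp at hx
    rcases hs with ((⟨h1, h2⟩ | ⟨h1, h2⟩) | ⟨h1, h2⟩) | ⟨h1, h2⟩ <;>
      simp only [Set.mem_ofPred_eq] at h1 h2
    · refine ⟨h1, ?_, ?_, ?_⟩
      · simpa using aux 0 (Or.inl h2.ne')
      · simpa using aux 1 (Or.inl h2.ne')
      · simpa using aux 2 (Or.inl h2.ne')
    · refine ⟨h1, ?_, ?_, ?_⟩
      · simpa using aux 0 (Or.inr h2.ne)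
      · simpa using aux 1 (Or.inr (by linarith))
      · simpa using aux 2 (Or.inr (by linarith))
    · refine ⟨h1, ?_, ?_, ?_⟩
      · simpa using aux 0 (Or.inl h2.ne)
      · simpa using aux 1 (Or.inl h2.ne)
      · simpa using aux 2 (Or.inl h2.ne)
    · refine ⟨by linarith, ?_, ?_, ?_⟩
      · simpa using aux 0 (Or.inr h1.ne')
      · simpa using aux 1 (Or.inr (by linarith))
      · simpa using aux 2 (Or.inr (by linarith))
  have hana : ∀ G : ℂ → ℂ,
      (∀ s : ℂ, -1 < s.re → s ≠ 0 → s ≠ 1 → s ≠ 2 → DifferentiableAt ℂ G s) →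
      AnalyticOnNhd ℂ G (((U ∪ S) ∪ V) ∪ T) := fun G hG =>
    DifferentiableOn.analyticOnNhd (fun s hs => by
      obtain ⟨h1, h2, h3, h4⟩ := hmem s hs
      exact (hG s h1 h2 h3 h4).differentiableWithinAt) hopen
  have h3 : (3 + Complex.I) ∈ ((U ∪ S) ∪ V) ∪ T := by
    left; left; left; constructor <;> simp; norm_num
  have heq := (hana L hL).eqOn_of_preconnected_of_eventuallyEq (hana R hR) hconn h3 (by
    filter_upwards [(o1 2).mem_nhds (show (3 + Complex.I) ∈ {s : ℂ | 2 < s.re} by simp; norm_num)]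
      with s hs using h s hs)
  filter_upwards [self_mem_nhdsWithin, nhdsWithin_le_nhds (Metric.ball_mem_nhds (0 : ℂ) one_pos)]
    with s hs0 hs1
  refine heq ?_
  have h4 : ‖s‖ < 1 := mem_ball_zero_iff.1 hs1
  have h5 := abs_lt.1 ((Complex.abs_re_le_norm s).trans_lt h4)
  rcases lt_trichotomy s.im 0 with h6 | h6 | h6
  · left; right; exact ⟨h5.1, h6⟩
  · rcases lt_trichotomy s.re 0 with h7 | h7 | h7
    · left; left; right; exact ⟨h5.1, h7⟩
    · exact (hs0 (Complex.ext h7 h6)).elim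
    · right; exact ⟨h7, h5.2⟩
  · left; left; left; exact ⟨h5.1, h6⟩

/-- The value at `s = 0` of the double zeta function of a representative. -/
noncomputable def coneValue (k : ℕ) (c d : ℤ) (z : ℂ) (i : ℤ × ℤ) : ℂ :=
  bernoulliFun 1 (coneX k c d i) * bernoulliFun 1 (coneY k c i) +
    bernoulliFun 2 (coneX k c d i) / 2 / (c * z + d) +
    bernoulliFun 2 (coneY k c i) / 2 * (c * z + d)

theorem coneY_nonneg {k : ℕ} {c : ℤ} (hc : 0 < c) {i : ℤ × ℤ}
    (hi : i ∈ coneBox k c) : 0 ≤ coneY k c i := by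
  simp only [coneBox, Finset.mem_product, Finset.mem_Ico, Finset.mem_Ioc] at hi
  have h3 : (0 : ℝ) ≤ i.1 := by exact_mod_cast hi.1.1
  have h4 : (0 : ℝ) < c := by exact_mod_cast hc
  rw [coneY]
  positivity

/-- Near `0` the continued difference is `-2i sin(πs)` times a sum of functions with at most a
simple pole. Since `sin(πs)/s → π`, the regular parts disappear and only the residues `coneValue`
remain. -/
theorem tendsto_gamma_mul_continuation_sub {k : ℕ} (hk : 0 < k) {f g u v : ℤ → ℂ}
    (hu : Function.Periodic u (k : ℤ)) (hv : Function.Periodic v (k : ℤ))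
    {a b c d : ℤ} (hdet : a * d - b * c = 1) (hc : 0 < c) {z : ℂ} (hz : 0 < z.im)
    (huv : ∀ m n, f (d * m - c * n) * g (-b * m + a * n) = u m * v n) {F₁ F₂ : ℂ → ℂ}
    (h₁ : IsEisensteinContinuation f g ((a * z + b) / (c * z + d)) F₁)
    (h₂ : IsEisensteinContinuation u v z F₂) :
    Tendsto (fun s : ℂ => Complex.Gamma s * (branchPow (c * z + d) (-s) * F₁ s - F₂ s)) (𝓝[≠] 0)
      (𝓝 (-(2 * Real.pi * Complex.I) *
        ∑ i ∈ coneBox k c, u (-i.1) * v (-coneShift c d i) * coneValue k c d z i)) := by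
  have hre := period_re_pos hk (d := d) hc hz
  have hτ : IsUpper (c * z + d) := Or.inl (linear_im_pos hc hz)
  set l := k * Complex.exp (-(halfArg c d z * Complex.I)) with hl
  have hl0 : l ≠ 0 := by
    intro h
    rw [h] at hre
    simp at hre
  have hex : ∀ i ∈ coneBox k c, _ := fun i hi =>
    exists_mellin_barnesKernel hre.1 hre.2 (coneX_pos hk hc d hi) (coneY_nonneg hc hi)
  choose! H hH using hex
  set P : ℤ × ℤ → ℂ → ℂ := fun i s => H i s + ((l * (l * (c * z + d)))⁻¹ / (s - 2) +
        (-(bernoulliFun 1 (coneY k c i) / l + bernoulliFun 1 (coneX k c d i) /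
          (l * (c * z + d)))) / (s - 1) + coneValue k c d z i / s) with hP
  have hPH : ∀ i ∈ coneBox k c, ∀ s : ℂ, 2 < s.re →
      mellin (barnesKernel l (l * (c * z + d)) (coneX k c d i) (coneY k c i)) s = P i s := by
    intro i hi s hs
    rw [(hH i hi).2 s hs]
    simp only [hP, coneValue]
    rw [mul_div_cancel_left₀ _ hl0, div_mul_cancel_left₀ hl0, div_eq_mul_inv _ (c * z + d : ℂ)]
  have hHd : ∀ i ∈ coneBox k c, ∀ s : ℂ, -1 < s.re → DifferentiableAt ℂ (H i) s :=
    fun i hi s hs => ((hH i hi).1 s hs).differentiableAt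
      ((isOpen_lt continuous_const Complex.continuous_re).mem_nhds hs)
  set R : ℂ → ℂ := fun s => -2 * Complex.I * Complex.sin (Real.pi * s) *
    (Complex.exp (-(halfArg c d z * Complex.I * s)) *
      ∑ i ∈ coneBox k c, u (-i.1) * v (-coneShift c d i) * P i s) with hR
  have heq : ∀ᶠ s in 𝓝[≠] (0 : ℂ),
      Complex.Gamma s * (branchPow (c * z + d) (-s) * F₁ s - F₂ s) = R s := by
    refine eventuallyEq_of_eq_of_two_lt_re (fun s hs h0 h1 h2 => ?_) (fun s hs h0 h1 h2 => ?_)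
      (fun s hs => ?_)
    · have hF : ∀ {f g z F}, IsEisensteinContinuation f g z F → DifferentiableAt ℂ F s :=
        fun h => (h.1 s h1).differentiableAt (isOpen_compl_singleton.mem_nhds h1)
      refine DifferentiableAt.mul (Complex.differentiableAt_Gamma s fun m hm => ?_) ?_
      · rcases m.eq_zero_or_pos with rfl | hm'
        · simp at hm
          exact h0 hm
        · rw [hm] at hs
          have : (1 : ℝ) ≤ m := by exact_mod_cast hm'
          simp at hs
          linarith
      · refine DifferentiableAt.sub (DifferentiableAt.mul ?_ (hF h₁)) (hF h₂)
        unfold branchPow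
        fun_prop
    · have hsum : DifferentiableAt ℂ
          (fun s => ∑ i ∈ coneBox k c, u (-i.1) * v (-coneShift c d i) * P i s) s := by
        refine DifferentiableAt.fun_sum fun i hi => DifferentiableAt.const_mul ?_ _
        refine (hHd i hi s hs).add ?_
        have e1 : s - 1 ≠ 0 := sub_ne_zero.2 h1
        have e2 : s - 2 ≠ 0 := sub_ne_zero.2 h2
        fun_prop (disch := assumption)
      refine DifferentiableAt.mul (by fun_prop) (DifferentiableAt.mul (by fun_prop) hsum)
    · rw [continuation_sub_eq_cone hk hu hv hdet hc hz huv h₁ h₂ hs, mul_left_comm,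
        gamma_mul_tsum_coneTerm hk hu hv hc hz hs]
      simp only [hR]
      congr 2
      exact Finset.sum_congr rfl fun i hi => by rw [← hl, hPH i hi s hs]
  refine Tendsto.congr' (EventuallyEq.symm heq) ?_
  have hsin : Tendsto (fun s : ℂ => Complex.sin (Real.pi * s) / s) (𝓝[≠] 0) (𝓝 Real.pi) := by
    have h3 : HasDerivAt (fun s : ℂ => Complex.sin (Real.pi * s)) Real.pi 0 := by
      have h4 := ((hasDerivAt_id (0 : ℂ)).const_mul (Real.pi : ℂ)).csin
      simpa using h4
    have h4 := hasDerivAt_iff_tendsto_slope.1 h3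
    refine h4.congr fun s => ?_
    simp [slope_def_field]
  have hsin0 : Tendsto (fun s : ℂ => Complex.sin (Real.pi * s)) (𝓝[≠] 0) (𝓝 0) :=
    (Continuous.tendsto' (by fun_prop) _ _ (by simp)).mono_left nhdsWithin_le_nhds
  have hexp : Tendsto (fun s : ℂ => Complex.exp (-(halfArg c d z * Complex.I * s))) (𝓝[≠] 0)
      (𝓝 1) :=
    (Continuous.tendsto' (by fun_prop) _ _ (by simp)).mono_left nhdsWithin_le_nhds
  have hPi : ∀ i ∈ coneBox k c, Tendsto (fun s => Complex.sin (Real.pi * s) * P i s) (𝓝[≠] 0)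
      (𝓝 (Real.pi * coneValue k c d z i)) := by
    intro i hi
    have h5 : ContinuousAt (fun s : ℂ => H i s + ((l * (l * (c * z + d)))⁻¹ / (s - 2) +
        (-(bernoulliFun 1 (coneY k c i) / l + bernoulliFun 1 (coneX k c d i) /
          (l * (c * z + d)))) / (s - 1))) 0 := by
      refine (hHd i hi 0 (by simp)).continuousAt.add ?_
      refine ContinuousAt.add ?_ ?_ <;>
      exact ContinuousAt.div (by fun_prop) (by fun_prop) (by simp)
    have h6 := (hsin0.mul (h5.tendsto.mono_left nhdsWithin_le_nhds)).add
      (hsin.mul_const (coneValue k c d z i))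
    rw [zero_mul, zero_add] at h6
    refine h6.congr fun s => ?_
    simp only [hP]
    ring
  have hlim := (hexp.mul (tendsto_finsetSum (coneBox k c) fun i hi =>
    (hPi i hi).const_mul (u (-i.1) * v (-coneShift c d i)))).const_mul (-2 * Complex.I)
  have hval : -2 * Complex.I * (1 * ∑ i ∈ coneBox k c, u (-i.1) * v (-coneShift c d i) *
      (Real.pi * coneValue k c d z i)) = -(2 * Real.pi * Complex.I) *
        ∑ i ∈ coneBox k c, u (-i.1) * v (-coneShift c d i) * coneValue k c d z i := by
    rw [one_mul, Finset.mul_sum, Finset.mul_sum]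
    exact Finset.sum_congr rfl fun i _ => by ring
  rw [← hval]
  refine hlim.congr fun s => ?_
  simp only [hR, Finset.mul_sum]
  exact Finset.sum_congr rfl fun i _ => by ring

/-! ### The Lipschitz formula -/

theorem ofReal_mul_cpow {r : ℝ} (hr : 0 < r) {w : ℂ} (hw : w ≠ 0) (s : ℂ) :
    ((r : ℂ) * w) ^ s = (r : ℂ) ^ s * w ^ s := by
  have hr' : (r : ℂ) ≠ 0 := by exact_mod_cast hr.ne'
  rw [Complex.cpow_def_of_ne_zero (mul_ne_zero hr' hw), Complex.log_ofReal_mul hr hw,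
    Complex.cpow_def_of_ne_zero hr', Complex.cpow_def_of_ne_zero hw, ← Complex.exp_add,
    Complex.ofReal_log hr.le, add_mul]

/-- The function whose values at the integers are summed on the side of the exponentials in the
Lipschitz formula. -/
noncomputable def lipschitzKernel (τ s : ℂ) (t : ℝ) : ℂ :=
  ((max t 0 : ℝ) : ℂ) ^ (s - 1) * Complex.exp (2 * Real.pi * Complex.I * τ * t)

theorem continuous_lipschitzKernel (τ : ℂ) {s : ℂ} (hs : 1 < s.re) :
    Continuous (lipschitzKernel τ s) := by
  have h1 : 0 < (s - 1).re := by simpa using hs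
  refine Continuous.mul ?_ (by fun_prop)
  exact (Complex.continuous_ofReal_cpow_const h1).comp (by fun_prop)

theorem lipschitzKernel_of_nonpos (τ : ℂ) {s : ℂ} (hs : 1 < s.re) {t : ℝ} (ht : t ≤ 0) :
    lipschitzKernel τ s t = 0 := by
  have h1 : s - 1 ≠ 0 := by
    intro h
    have := congrArg Complex.re h
    simp at this
    linarith
  rw [lipschitzKernel, max_eq_right ht, Complex.ofReal_zero, Complex.zero_cpow h1, zero_mul]

theorem lipschitzKernel_isBigO {τ : ℂ} (hτ : 0 < τ.im) {s : ℂ} (hs : 1 < s.re) :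
    lipschitzKernel τ s =O[cocompact ℝ] fun t => |t| ^ (-s.re) := by
  rw [cocompact_eq_atBot_atTop, Asymptotics.isBigO_sup]
  constructor
  · refine (Asymptotics.isBigO_zero _ _).congr' ?_ EventuallyEq.rfl
    filter_upwards [eventually_le_atBot (0 : ℝ)] with t ht
    rw [lipschitzKernel_of_nonpos τ hs ht]
  · have h1 := (isLittleO_exp_neg_mul_rpow_atTop (mul_pos Real.two_pi_pos hτ)
      (-s.re - (s.re - 1))).isBigO
    have h2 := (Asymptotics.isBigO_refl (fun t : ℝ => t ^ (s.re - 1)) atTop).mul h1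
    refine Asymptotics.IsBigO.trans (Asymptotics.IsBigO.of_bound 1 ?_) (h2.congr'
      EventuallyEq.rfl ?_)
    · filter_upwards [eventually_gt_atTop (0 : ℝ)] with t ht
      rw [lipschitzKernel, max_eq_left ht.le, norm_mul, Complex.norm_cpow_eq_rpow_re_of_pos ht,
        Complex.norm_exp, one_mul, norm_mul, Real.norm_of_nonneg (by positivity),
        Real.norm_of_nonneg (by positivity)]
      apply le_of_eq
      simp
    · filter_upwards [eventually_gt_atTop (0 : ℝ)] with t ht
      rw [← Real.rpow_add ht, abs_of_pos ht]
      ring_nf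

-- The kernel vanishes on the negative axis, so the Fourier integral is the Mellin transform of
-- `exp(-wt)` with `w = 2πi(ξ - τ)`, whose real part is `2π Im τ > 0`.
open MeasureTheory Set FourierTransform in
theorem fourier_lipschitzKernel {τ : ℂ} (hτ : 0 < τ.im) {s : ℂ} (hs : 1 < s.re) (ξ : ℝ) :
    𝓕 (lipschitzKernel τ s) ξ =
      Complex.Gamma s * (2 * Real.pi * Complex.I * (ξ - τ)) ^ (-s) := by
  have hre : 0 < (2 * Real.pi * Complex.I * (ξ - τ) : ℂ).re := by
    simp
    positivity
  rw [← mellin_exp_neg_mul hre (by linarith), Real.fourier_real_eq_integral_exp_smul, mellin,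
    ← integral_indicator measurableSet_Ioi]
  congr 1
  ext t
  by_cases ht : 0 < t
  · rw [indicator_of_mem (show t ∈ Ioi 0 from ht), lipschitzKernel, max_eq_left ht.le, smul_eq_mul,
      smul_eq_mul, mul_left_comm, ← Complex.exp_add]
    push_cast
    ring_nf
  · rw [indicator_of_notMem (show t ∉ Ioi 0 from ht), lipschitzKernel_of_nonpos τ hs (not_lt.1 ht),
      smul_zero]

open FourierTransform in
theorem fourier_lipschitzKernel_isBigO {τ : ℂ} (hτ : 0 < τ.im) {s : ℂ} (hs : 1 < s.re) :
    𝓕 (lipschitzKernel τ s) =O[cocompact ℝ] fun t => |t| ^ (-s.re) := by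
  -- The factor `exp(π|Im s|)` bounds the contribution of the argument to `|w^(-s)|`.
  refine Asymptotics.IsBigO.of_bound (‖Complex.Gamma s‖ * Real.exp (Real.pi * |s.im|)) ?_
  have h1 : ∀ᶠ ξ : ℝ in cocompact ℝ, 2 * ‖τ‖ + 1 ≤ ‖ξ‖ :=
    tendsto_norm_cocompact_atTop.eventually (eventually_ge_atTop _)
  filter_upwards [h1] with ξ hξ
  have h2 : ‖ξ‖ / 2 ≤ ‖(ξ - τ : ℂ)‖ := by
    have := norm_sub_norm_le (ξ : ℂ) τ
    rw [Complex.norm_real] at this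
    linarith
  have h0 : 0 < ‖ξ‖ := by linarith [norm_nonneg τ]
  have h3 : ‖ξ‖ ≤ ‖(2 * Real.pi * Complex.I * (ξ - τ) : ℂ)‖ := by
    rw [norm_mul, norm_mul, norm_mul, Complex.norm_I, Complex.norm_real,
      Real.norm_of_nonneg Real.pi_pos.le]
    simp only [Complex.norm_ofNat, mul_one]
    nlinarith [Real.pi_gt_three]
  have h4 : (2 * Real.pi * Complex.I * (ξ - τ) : ℂ) ≠ 0 := norm_pos_iff.1 (h0.trans_le h3)
  rw [fourier_lipschitzKernel hτ hs]
  generalize (2 * Real.pi * Complex.I * (ξ - τ) : ℂ) = w at h3 h4 ⊢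
  rw [norm_mul, Complex.norm_cpow_of_ne_zero h4, mul_assoc, div_eq_mul_inv, ← Real.exp_neg,
    mul_comm (Real.exp _), Real.norm_of_nonneg (by positivity : 0 ≤ |ξ| ^ (-s.re)), Complex.neg_re]
  gcongr ?_ * (?_ * ?_)
  · exact Real.rpow_le_rpow_of_nonpos h0 h3 (by linarith)
  · rw [Real.exp_le_exp]
    have h5 := Complex.abs_arg_le_pi w
    calc _ = w.arg * s.im := by simp
      _ ≤ |w.arg * s.im| := le_abs_self _
      _ ≤ _ := by rw [abs_mul]; gcongr

/-- The constant in the Lipschitz formula. -/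
noncomputable def lipschitzConst (s : ℂ) : ℂ :=
  ((2 * Real.pi : ℝ) : ℂ) ^ s * Complex.exp (-(((Real.pi / 2 : ℝ) : ℂ) * Complex.I * s))

/-- The Lipschitz formula for the sum of `(τ + n) ^ (-s)` over the integers. -/
theorem lipschitz_formula {τ : ℂ} (hτ : 0 < τ.im) {s : ℂ} (hs : 1 < s.re) :
    ∑' n : ℤ, (τ + n) ^ (-s) = lipschitzConst s * (Complex.Gamma s)⁻¹ *
      ∑' n : ℕ, (((n + 1 : ℕ) : ℂ) ^ (s - 1) *
        Complex.exp (2 * Real.pi * Complex.I * τ * ((n + 1 : ℕ) : ℂ))) := by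
  -- Poisson summation at `0`. The rest identifies the two sides: positive integers for the kernel,
  -- and, after `n ↦ -n`, the powers of `2πi(-n - τ) = 2π·(-i)(τ + n)`. The rotation by `-i`
  -- produces `lipschitzConst`.
  have hp := Real.tsum_eq_tsum_fourier_of_rpow_decay (continuous_lipschitzKernel τ hs) hs
    (lipschitzKernel_isBigO hτ hs) (fourier_lipschitzKernel_isBigO hτ hs) 0
  simp only [zero_add, QuotientAddGroup.mk_zero, fourier_eval_zero, mul_one] at hp
  have hleft : ∑' n : ℤ, lipschitzKernel τ s n = ∑' n : ℕ, (((n + 1 : ℕ) : ℂ) ^ (s - 1) *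
        Complex.exp (2 * Real.pi * Complex.I * τ * ((n + 1 : ℕ) : ℂ))) := by
    have hinj : Function.Injective fun n : ℕ => ((n + 1 : ℕ) : ℤ) := fun a b h => by
      simp at h
      exact h
    rw [← hinj.tsum_eq]
    · refine tsum_congr fun n => ?_
      rw [lipschitzKernel, max_eq_left (by positivity)]
      simp
    · intro n hn
      have h1 : 0 < n := by
        by_contra h
        exact hn (lipschitzKernel_of_nonpos τ hs (by exact_mod_cast not_lt.1 h))
      refine ⟨(n - 1).toNat, ?_⟩
      simp only
      omega
  have hG : Complex.Gamma s ≠ 0 := Complex.Gamma_ne_zero_of_re_pos (by linarith)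
  have hright : ∀ n : ℤ, Complex.Gamma s * (2 * Real.pi * Complex.I * (((-n : ℤ) : ℝ) - τ)) ^ (-s) =
      (Complex.Gamma s * (lipschitzConst s)⁻¹) * (τ + n) ^ (-s) := fun n => by
    have h1 : IsUpper (τ + n) := Or.inl (by simpa using hτ)
    have h2 : Complex.exp (-(((Real.pi / 2 : ℝ) : ℂ) * Complex.I)) = -Complex.I := by
      rw [Complex.exp_neg]
      push_cast
      rw [Complex.exp_pi_div_two_mul_I, Complex.inv_I]
    have h3 := cpow_eq_exp_mul_cpow h1 (φ := Real.pi / 2) (by positivity)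
      (by linarith [Real.pi_pos]) (-s)
    rw [h2] at h3
    have h4 : (2 * Real.pi * Complex.I * (((-n : ℤ) : ℝ) - τ) : ℂ) =
        ((2 * Real.pi : ℝ) : ℂ) * (-Complex.I * (τ + n)) := by
      push_cast
      ring
    rw [h4, ofReal_mul_cpow Real.two_pi_pos (mul_ne_zero (neg_ne_zero.2 Complex.I_ne_zero)
      h1.ne_zero), h3, lipschitzConst, Complex.cpow_neg, mul_inv, ← Complex.exp_neg, neg_neg,
      mul_neg, Complex.exp_neg]
    field_simp [Complex.exp_ne_zero]
  have hC : lipschitzConst s ≠ 0 := by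
    rw [lipschitzConst]
    refine mul_ne_zero ?_ (Complex.exp_ne_zero _)
    rw [Complex.cpow_def_of_ne_zero (by simp [Real.pi_ne_zero])]
    exact Complex.exp_ne_zero _
  rw [hleft, ← (Equiv.neg ℤ).tsum_eq] at hp
  simp only [Equiv.neg_apply] at hp
  rw [hp]
  simp_rw [fourier_lipschitzKernel hτ hs, hright]
  rw [tsum_mul_left]
  field_simp

/-! ### Existence of the continuations -/

/-- The finite Fourier transform of a periodic sequence. -/
noncomputable def fourierSum (k : ℕ) (g : ℤ → ℂ) (n : ℕ) : ℂ :=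
  ∑ j ∈ Finset.range k, g j * Complex.exp (2 * Real.pi * Complex.I * (j / k) * n)

theorem summable_succ_pow_mul_geometric (N : ℕ) {r : ℝ} (h0 : 0 ≤ r) (h1 : r < 1) :
    Summable fun n : ℕ => ((n : ℝ) + 1) ^ N * r ^ n := by
  have h2 : ‖r‖ < 1 := by rwa [Real.norm_of_nonneg h0]
  induction N with
  | zero => simpa using summable_geometric_of_lt_one h0 h1
  | succ N _ =>
    have h3 : Summable fun n : ℕ => (2 : ℝ) ^ (N + 1) * ((n : ℝ) ^ (N + 1) * r ^ n) :=
      (summable_pow_mul_geometric_of_norm_lt_one (N + 1) h2).mul_left _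
    refine Summable.of_norm_bounded_eventually_nat h3 ?_
    filter_upwards [eventually_ge_atTop 1] with n hn
    have hn' : (1 : ℝ) ≤ n := by exact_mod_cast hn
    rw [Real.norm_of_nonneg (by positivity), ← mul_assoc, ← mul_pow]
    gcongr
    linarith

theorem norm_succ_cpow_le {s : ℂ} {N : ℕ} (hN : s.re ≤ N) (n : ℕ) :
    ‖((n + 1 : ℕ) : ℂ) ^ (s - 1)‖ ≤ ((n : ℝ) + 1) ^ N := by
  rw [Complex.norm_natCast_cpow_of_pos n.succ_pos, ← Real.rpow_natCast]
  push_cast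
  refine Real.rpow_le_rpow_of_exponent_le (by linarith [(Nat.cast_nonneg n : (0 : ℝ) ≤ n)]) ?_
  simp
  linarith

theorem norm_exp_two_pi_I_mul (τ : ℂ) (n : ℕ) :
    ‖Complex.exp (2 * Real.pi * Complex.I * τ * (n : ℂ))‖ = Real.exp (-(2 * Real.pi * τ.im)) ^ n := by
  rw [Complex.norm_exp, ← Real.exp_nat_mul]
  congr 1
  simp
  ring

theorem exp_neg_two_pi_mul_lt_one {y : ℝ} (hy : 0 < y) : Real.exp (-(2 * Real.pi * y)) < 1 := by
  rw [Real.exp_lt_one_iff, neg_lt_zero]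
  positivity

theorem summable_lipschitz {τ : ℂ} (hτ : 0 < τ.im) (s : ℂ) :
    Summable fun n : ℕ => (((n + 1 : ℕ) : ℂ) ^ (s - 1) *
        Complex.exp (2 * Real.pi * Complex.I * τ * ((n + 1 : ℕ) : ℂ))) := by
  obtain ⟨N, hN⟩ := exists_nat_ge s.re
  refine Summable.of_norm_bounded (summable_succ_pow_mul_geometric N (Real.exp_nonneg _)
    (exp_neg_two_pi_mul_lt_one hτ)) fun n => ?_
  rw [norm_mul, norm_exp_two_pi_I_mul]
  exact mul_le_mul (norm_succ_cpow_le hN n) (pow_le_pow_of_le_one (Real.exp_nonneg _)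
    (exp_neg_two_pi_mul_lt_one hτ).le n.le_succ) (by positivity) (by positivity)

theorem periodic_neg {k : ℕ} {g : ℤ → ℂ} (hg : Function.Periodic g (k : ℤ)) :
    Function.Periodic (fun n => g (-n)) (k : ℤ) := fun n => by
  simp only [neg_add]
  exact hg.sub_eq (-n)

theorem row_eq {k : ℕ} (hk : 0 < k) {g : ℤ → ℂ} (hg : Function.Periodic g (k : ℤ)) {w : ℂ}
    (hw : 0 < w.im) {s : ℂ} (hs : 2 < s.re) :
    ∑' n : ℤ, g n * (w + n) ^ (-s) = (k : ℂ) ^ (-s) * (lipschitzConst s * (Complex.Gamma s)⁻¹) *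
      ∑' n : ℕ, fourierSum k g (n + 1) * (((n + 1 : ℕ) : ℂ) ^ (s - 1) *
        Complex.exp (2 * Real.pi * Complex.I * (w / k) * ((n + 1 : ℕ) : ℂ))) := by
  have : NeZero k := ⟨hk.ne'⟩
  have hk' : (k : ℂ) ≠ 0 := by exact_mod_cast hk.ne'
  have hkr : (0 : ℝ) < k := by exact_mod_cast hk
  have hup : ∀ n : ℤ, IsUpper (w + n) := fun n => Or.inl (by simpa using hw)
  have hsum : Summable fun n : ℤ => g n * (w + n) ^ (-s) := by
    -- The row is the slice `m = 1` of the Eisenstein series at the point `w` with first sequence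
    -- constant, which gives its summability.
    have h1 := (summable_eisensteinTerm hk (f := fun _ => 1) (fun _ => rfl) hg hw hs).prod_factor 1
    refine h1.congr fun n => ?_
    simp only [eisensteinTerm, Prod.mk.injEq, one_ne_zero, false_and, if_false, Int.cast_one,
      one_mul]
    rw [branchPow_of_isUpper (hup n)]
  -- Writing `n = qk + j` makes `g` constant on each class, and `w + n = k((w + j)/k + q)` puts the
  -- inner sum in Lipschitz form. The factors `exp(2πi jn/k)` then assemble into `fourierSum`.
  rw [← ((Equiv.prodComm _ _).trans (Int.divModEquiv k).symm).tsum_eq]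
  have hsum' := ((Equiv.prodComm _ _).trans (Int.divModEquiv k).symm).summable_iff.2 hsum
  have h1 := hsum'.tsum_prod
  simp only [Function.comp] at h1
  rw [h1, tsum_fintype]
  have him : ∀ j : ℕ, 0 < ((w + j) / k : ℂ).im := fun j => by
    rw [← Complex.ofReal_natCast k, Complex.div_ofReal_im]
    simpa using div_pos hw hkr
  have h2 : ∀ j : Fin k, ∑' q : ℤ,
      g (((Equiv.prodComm (Fin k) ℤ).trans (Int.divModEquiv k).symm) (j, q)) *
        (w + (((Equiv.prodComm (Fin k) ℤ).trans (Int.divModEquiv k).symm) (j, q) : ℤ)) ^ (-s) =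
      g (j : ℕ) * ((k : ℂ) ^ (-s) * ∑' q : ℤ, ((w + (j : ℕ)) / k + q) ^ (-s)) := fun j => by
    rw [← tsum_mul_left, ← tsum_mul_left]
    refine tsum_congr fun q => ?_
    have e1 : ((Equiv.prodComm (Fin k) ℤ).trans (Int.divModEquiv k).symm) (j, q) =
        q * k + (j : ℕ) := rfl
    have e2 : g (q * k + (j : ℕ)) = g (j : ℕ) := by
      rw [add_comm]
      simpa using hg.int_mul q (j : ℕ)
    have e3 : (w + ((q * k + (j : ℕ) : ℤ) : ℂ)) = ((k : ℝ) : ℂ) * ((w + (j : ℕ)) / k + q) := by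
      push_cast
      field_simp
      ring
    rw [e1, e2, e3, ofReal_mul_cpow hkr, Complex.ofReal_natCast]
    exact IsUpper.ne_zero (Or.inl (by simpa using him j))
  rw [Finset.sum_congr rfl fun j _ => h2 j,
    Fin.sum_univ_eq_sum_range (fun j : ℕ => g (j : ℕ) * ((k : ℂ) ^ (-s) *
      ∑' q : ℤ, ((w + (j : ℕ)) / k + q) ^ (-s))) k]
  simp only [fourierSum, Finset.sum_mul]
  rw [Summable.tsum_finsetSum, Finset.mul_sum]
  · refine Finset.sum_congr rfl fun j _ => ?_
    rw [lipschitz_formula (him j) (by linarith)]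
    have h3 : ∀ n : ℕ, g j * Complex.exp (2 * Real.pi * Complex.I * (j / k) * ((n + 1 : ℕ) : ℂ)) *
        (((n + 1 : ℕ) : ℂ) ^ (s - 1) *
          Complex.exp (2 * Real.pi * Complex.I * (w / k) * ((n + 1 : ℕ) : ℂ))) =
        g j * (((n + 1 : ℕ) : ℂ) ^ (s - 1) *
          Complex.exp (2 * Real.pi * Complex.I * ((w + j) / k) * ((n + 1 : ℕ) : ℂ))) := fun n => by
      have h4 : Complex.exp (2 * Real.pi * Complex.I * ((w + j) / k) * ((n + 1 : ℕ) : ℂ)) =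
          Complex.exp (2 * Real.pi * Complex.I * (j / k) * ((n + 1 : ℕ) : ℂ)) *
            Complex.exp (2 * Real.pi * Complex.I * (w / k) * ((n + 1 : ℕ) : ℂ)) := by
        rw [← Complex.exp_add]
        ring_nf
      rw [h4]
      ring
    simp_rw [h3]
    rw [tsum_mul_left]
    ring
  · intro j _
    refine ((summable_lipschitz (him j) s).mul_left (g j)).congr fun n => ?_
    have h4 : Complex.exp (2 * Real.pi * Complex.I * ((w + j) / k) * ((n + 1 : ℕ) : ℂ)) =
        Complex.exp (2 * Real.pi * Complex.I * (j / k) * ((n + 1 : ℕ) : ℂ)) *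
          Complex.exp (2 * Real.pi * Complex.I * (w / k) * ((n + 1 : ℕ) : ℂ)) := by
      rw [← Complex.exp_add]
      ring_nf
    rw [h4]
    ring

/-- The terms of the double `q`-series of the Eisenstein series. -/
noncomputable def qTerm (k : ℕ) (f g : ℤ → ℂ) (z s : ℂ) (p : ℕ × ℕ) : ℂ :=
  f ((p.1 + 1 : ℕ) : ℤ) * (fourierSum k g (p.2 + 1) * (((p.2 + 1 : ℕ) : ℂ) ^ (s - 1) *
    Complex.exp (2 * Real.pi * Complex.I * (((p.1 + 1 : ℕ) : ℂ) * z / k) * ((p.2 + 1 : ℕ) : ℂ))))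

/-- The exponential is at most `r^((m+1)(n+1)) ≤ r^m r^n` with `r < 1`, which beats the polynomial
growth of `(n + 1)^(s-1)` uniformly on `Re s < R`. This uniformity makes the sum of the `q`-series
entire in `s`. -/
theorem exists_summable_bound_qTerm {k : ℕ} (hk : 0 < k) {f g : ℤ → ℂ}
    (hf : Function.Periodic f (k : ℤ)) {z : ℂ} (hz : 0 < z.im) (R : ℝ) :
    ∃ b : ℕ × ℕ → ℝ, Summable b ∧ ∀ p : ℕ × ℕ, ∀ s : ℂ, s.re < R → ‖qTerm k f g z s p‖ ≤ b p := by
  obtain ⟨C, hC, hfC⟩ := exists_norm_le_of_periodic hk hf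
  obtain ⟨N, hN⟩ := exists_nat_ge R
  have hkr : (0 : ℝ) < k := by exact_mod_cast hk
  have hy : 0 < z.im / k := by positivity
  set r := Real.exp (-(2 * Real.pi * (z.im / k))) with hr
  have hr0 : 0 ≤ r := Real.exp_nonneg _
  have hr1 : r < 1 := exp_neg_two_pi_mul_lt_one hy
  set D := ∑ j ∈ Finset.range k, ‖g j‖ with hD
  refine ⟨fun p => C * (D * (r ^ p.1 * (((p.2 : ℝ) + 1) ^ N * r ^ p.2))), ?_, fun p s hs => ?_⟩
  · exact (((summable_geometric_of_lt_one hr0 hr1).mul_of_nonneg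
      (summable_succ_pow_mul_geometric N hr0 hr1) (fun n => by positivity)
      (fun n => by positivity)).mul_left D).mul_left C
  · have h1 : ‖fourierSum k g (p.2 + 1)‖ ≤ D := by
      refine (norm_sum_le _ _).trans (Finset.sum_le_sum fun j _ => ?_)
      have h2 : (2 * Real.pi * Complex.I * (j / k) * ((p.2 + 1 : ℕ) : ℂ)) =
          ((2 * Real.pi * (j / k) * (p.2 + 1 : ℕ) : ℝ) : ℂ) * Complex.I := by
        push_cast
        ring
      rw [norm_mul, h2, Complex.norm_exp_ofReal_mul_I, mul_one]
    have h2 : (((p.1 + 1 : ℕ) : ℂ) * z / k).im = (p.1 + 1 : ℕ) * (z.im / k) := by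
      rw [← Complex.ofReal_natCast k, Complex.div_ofReal_im, ← Complex.ofReal_natCast,
        Complex.im_ofReal_mul, mul_div_assoc]
    have h3 : ‖Complex.exp (2 * Real.pi * Complex.I * (((p.1 + 1 : ℕ) : ℂ) * z / k) *
        ((p.2 + 1 : ℕ) : ℂ))‖ ≤ r ^ p.1 * r ^ p.2 := by
      rw [norm_exp_two_pi_I_mul, h2, ← pow_add]
      have h4 : Real.exp (-(2 * Real.pi * ((p.1 + 1 : ℕ) * (z.im / k)))) = r ^ (p.1 + 1) := by
        rw [hr, ← Real.exp_nat_mul]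
        congr 1
        ring
      rw [h4, ← pow_mul]
      exact pow_le_pow_of_le_one hr0 hr1.le (by nlinarith)
    rw [qTerm, norm_mul, norm_mul, norm_mul]
    calc _ ≤ C * (D * ((((p.2 : ℝ) + 1) ^ N) * (r ^ p.1 * r ^ p.2))) := by
          gcongr
          · exact hfC _
          · exact norm_succ_cpow_le (hs.le.trans hN) _
      _ = _ := by ring

theorem summable_qTerm {k : ℕ} (hk : 0 < k) {f g : ℤ → ℂ}
    (hf : Function.Periodic f (k : ℤ)) {z : ℂ} (hz : 0 < z.im) (s : ℂ) :
    Summable (qTerm k f g z s) := by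
  obtain ⟨b, hb, h⟩ := exists_summable_bound_qTerm hk (g := g) hf hz (s.re + 1)
  exact Summable.of_norm_bounded hb fun p => h p s (by linarith)

theorem differentiable_tsum_qTerm {k : ℕ} (hk : 0 < k) {f g : ℤ → ℂ}
    (hf : Function.Periodic f (k : ℤ)) {z : ℂ} (hz : 0 < z.im) :
    Differentiable ℂ fun s => ∑' p, qTerm k f g z s p := fun s => by
  obtain ⟨b, hb, h⟩ := exists_summable_bound_qTerm hk (g := g) hf hz (s.re + 1)
  have hopen : IsOpen {v : ℂ | v.re < s.re + 1} := isOpen_lt Complex.continuous_re continuous_const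
  refine (Complex.differentiableOn_tsum_of_summable_norm hb (fun p => ?_) hopen
    fun p v hv => h p v hv).differentiableAt (hopen.mem_nhds (by simp))
  refine Differentiable.differentiableOn ?_
  unfold qTerm
  have h1 : ((p.2 + 1 : ℕ) : ℂ) ≠ 0 := by exact_mod_cast p.2.succ_ne_zero
  have h2 : Differentiable ℂ fun v : ℂ => ((p.2 + 1 : ℕ) : ℂ) ^ (v - 1) :=
    Differentiable.const_cpow (by fun_prop) (Or.inl h1)
  fun_prop

/-- The continuation of a Dirichlet series with periodic coefficients. -/
theorem exists_periodic_LFunction {k : ℕ} (hk : 0 < k) {g : ℤ → ℂ}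
    (hg : Function.Periodic g (k : ℤ)) :
    ∃ L : ℂ → ℂ, (∀ s, s ≠ 1 → DifferentiableAt ℂ L s) ∧ ∀ s : ℂ, 1 < s.re →
      L s = ∑' n : ℕ, g ((n + 1 : ℕ) : ℤ) * ((n + 1 : ℕ) : ℂ) ^ (-s) := by
  have : NeZero k := ⟨hk.ne'⟩
  set Φ : ZMod k → ℂ := fun x => g (x.val : ℤ) with hΦ
  have h1 : ∀ n : ℕ, Φ (n : ZMod k) = g (n : ℤ) := fun n => by
    simp only [hΦ, ZMod.val_natCast]
    conv_rhs => rw [← Nat.mod_add_div n k]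
    have := hg.int_mul ((n / k : ℕ) : ℤ) ((n % k : ℕ) : ℤ)
    push_cast at this ⊢
    rw [mul_comm (k : ℤ)]
    exact this.symm
  refine ⟨ZMod.LFunction Φ, fun s hs => ZMod.differentiableAt_LFunction Φ s (Or.inl hs),
    fun s hs => ?_⟩
  have h2 := ZMod.LSeriesSummable_of_one_lt_re Φ hs
  rw [ZMod.LFunction_eq_LSeries Φ hs, LSeries, h2.tsum_eq_zero_add, LSeries.term_zero, zero_add]
  refine tsum_congr fun n => ?_
  rw [LSeries.term_of_ne_zero n.succ_ne_zero, h1, Complex.cpow_neg, div_eq_mul_inv]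

theorem tsum_eisensteinTerm_row {k : ℕ} (hk : 0 < k) {f g : ℤ → ℂ}
    (hg : Function.Periodic g (k : ℤ)) {z : ℂ}
    (hz : 0 < z.im) {s : ℂ} (hs : 2 < s.re) (m : ℕ) :
    ∑' n : ℤ, eisensteinTerm f g z s ((m : ℤ) + 1, n) =
      (k : ℂ) ^ (-s) * (lipschitzConst s * (Complex.Gamma s)⁻¹) * ∑' n, qTerm k f g z s (m, n) := by
  have hw : 0 < (((m + 1 : ℕ) : ℂ) * z).im := by
    rw [← Complex.ofReal_natCast, Complex.im_ofReal_mul]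
    positivity
  have h1 := row_eq hk hg hw hs
  simp only [qTerm]
  rw [tsum_mul_left, mul_left_comm, ← h1, ← tsum_mul_left]
  refine tsum_congr fun n => ?_
  have h2 : ((m : ℤ) + 1, n) ≠ ((0, 0) : ℤ × ℤ) := by
    intro h
    simp at h
    omega
  rw [eisensteinTerm, if_neg h2]
  have h3 : (((m : ℤ) + 1 : ℤ) : ℂ) * z + n = ((m + 1 : ℕ) : ℂ) * z + n := by push_cast; ring
  simp only
  rw [h3, branchPow_of_isUpper (Or.inl (by simpa using hw))]
  push_cast
  ring

/-- The normalisation `arg ∈ [-π, π)` gives `-w` the argument `arg w - π`, hence the factor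
`exp(πis)` on the rows with `m < 0` and on the negative half of the row `m = 0`. -/
theorem eisensteinTerm_neg {f g : ℤ → ℂ} {z s : ℂ} {p : ℤ × ℤ} (hp : p ≠ 0)
    (h : IsUpper ((p.1 : ℂ) * z + p.2)) :
    eisensteinTerm f g z s (-p) = Complex.exp (Real.pi * Complex.I * s) *
      eisensteinTerm (fun n => f (-n)) (fun n => g (-n)) z s p := by
  have hp' : p ≠ (0, 0) := hp
  have hp'' : -p ≠ (0, 0) := fun h => hp (neg_eq_zero.1 h)
  have h4 : ((-p).1 : ℂ) * z + ((-p).2 : ℂ) = -((p.1 : ℂ) * z + p.2) := by simp; ring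
  rw [eisensteinTerm, eisensteinTerm, if_neg hp', if_neg hp'', h4, branchPow_neg h,
    branchPow_of_isUpper h, mul_neg, neg_neg]
  simp only [Prod.fst_neg, Prod.snd_neg]
  ring

theorem exists_isEisensteinContinuation {k : ℕ} (hk : 0 < k) {f g : ℤ → ℂ}
    (hf : Function.Periodic f (k : ℤ)) (hg : Function.Periodic g (k : ℤ)) {z : ℂ}
    (hz : 0 < z.im) : ∃ F, IsEisensteinContinuation f g z F := by
  obtain ⟨L, hLd, hL⟩ := exists_periodic_LFunction hk hg
  obtain ⟨L', hLd', hL'⟩ := exists_periodic_LFunction hk (periodic_neg hg)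
  have hk' : (k : ℂ) ≠ 0 := by exact_mod_cast hk.ne'
  -- The first summand is the row `m = 0`; the two `q`-series are the rows `m > 0` and `m < 0`.
  -- `1/Γ` is entire, so only the Dirichlet series `L` and `L'` can be singular, and only at `s =
  -- 1`.
  refine ⟨fun s => f 0 * (L s + Complex.exp (Real.pi * Complex.I * s) * L' s) +
    (k : ℂ) ^ (-s) * (lipschitzConst s * (Complex.Gamma s)⁻¹) * (∑' p, qTerm k f g z s p +
      Complex.exp (Real.pi * Complex.I * s) *
        ∑' p, qTerm k (fun n => f (-n)) (fun n => g (-n)) z s p), fun s hs => ?_, fun s hs => ?_⟩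
  · refine DifferentiableAt.differentiableWithinAt ?_
    have d1 := hLd s hs
    have d2 := hLd' s hs
    have d3 := differentiable_tsum_qTerm hk (g := g) hf hz s
    have d4 := differentiable_tsum_qTerm hk (g := fun n => g (-n)) (periodic_neg hf) hz s
    have d5 : DifferentiableAt ℂ (fun s => (Complex.Gamma s)⁻¹) s :=
      Complex.differentiable_one_div_Gamma s
    have d6 : DifferentiableAt ℂ (fun s : ℂ => (k : ℂ) ^ (-s)) s :=
      DifferentiableAt.const_cpow (by fun_prop) (Or.inl hk')
    have d7 : DifferentiableAt ℂ lipschitzConst s := by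
      unfold lipschitzConst
      refine DifferentiableAt.mul (DifferentiableAt.const_cpow (by fun_prop) (Or.inl ?_))
        (by fun_prop)
      exact_mod_cast Real.two_pi_pos.ne'
    fun_prop
  · have hsum := summable_eisensteinTerm hk hf hg hz hs
    refine hsum.hasSum_iff.2 ?_
    set r : ℤ → ℂ := fun m => ∑' n, eisensteinTerm f g z s (m, n) with hr_def
    have hr : Summable r := hsum.prod
    have hinj1 : Function.Injective fun n : ℕ => (n : ℤ) + 1 := fun a b h => by simpa using h
    have hinj2 : Function.Injective fun n : ℕ => -((n : ℤ) + 1) := fun a b h => by simpa using h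
    have hr1 : Summable fun n : ℕ => r (n + 1) := hr.comp_injective hinj1
    have hr2 : Summable fun n : ℕ => r (-(n + 1)) := hr.comp_injective hinj2
    have htot : ∑' p, eisensteinTerm f g z s p = ∑' m, r m := hsum.tsum_prod
    rw [htot, tsum_of_add_one_of_neg_add_one hr1 hr2]
    have e1 : ∑' m : ℕ, r ((m : ℤ) + 1) =
        (k : ℂ) ^ (-s) * (lipschitzConst s * (Complex.Gamma s)⁻¹) * ∑' p, qTerm k f g z s p := by
      rw [(summable_qTerm hk hf hz s).tsum_prod, ← tsum_mul_left]
      exact tsum_congr fun m => tsum_eisensteinTerm_row hk hg hz hs m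
    have e2 : ∑' m : ℕ, r (-((m : ℤ) + 1)) =
        Complex.exp (Real.pi * Complex.I * s) * ((k : ℂ) ^ (-s) *
          (lipschitzConst s * (Complex.Gamma s)⁻¹) *
            ∑' p, qTerm k (fun n => f (-n)) (fun n => g (-n)) z s p) := by
      rw [(summable_qTerm hk (periodic_neg hf) hz s).tsum_prod, ← tsum_mul_left, ← tsum_mul_left]
      refine tsum_congr fun m => ?_
      rw [← tsum_eisensteinTerm_row (f := fun n => f (-n)) hk (periodic_neg hg) hz hs m,
        ← tsum_mul_left, hr_def]
      simp only
      rw [← (Equiv.neg ℤ).tsum_eq]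
      refine tsum_congr fun n => ?_
      have hp : (((m : ℤ) + 1, n) : ℤ × ℤ) ≠ 0 := by
        intro h
        simp [Prod.ext_iff] at h
        omega
      rw [← eisensteinTerm_neg hp]
      · rfl
      · rw [isUpper_int_mul_add_int hz]
        left
        simp only
        omega
    have hrow := hsum.prod_factor 0
    have hposU : ∀ n : ℕ, IsUpper (((0 : ℤ) : ℂ) * z + (((n : ℤ) + 1 : ℤ) : ℂ)) := fun n =>
      (isUpper_int_mul_add_int hz (p := (0, (n : ℤ) + 1))).2 (Or.inr ⟨rfl, by simp only; omega⟩)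
    have hpos : ∀ (f g : ℤ → ℂ) (n : ℕ), eisensteinTerm f g z s (0, (n : ℤ) + 1) =
        f 0 * (g ((n + 1 : ℕ) : ℤ) * ((n + 1 : ℕ) : ℂ) ^ (-s)) := fun f g n => by
      have hp : ((0, (n : ℤ) + 1) : ℤ × ℤ) ≠ (0, 0) := by
        intro h
        simp at h
        omega
      rw [eisensteinTerm, if_neg hp]
      simp only
      rw [branchPow_of_isUpper (hposU n)]
      push_cast
      simp only [zero_mul, zero_add]
      ring
    have e3 : r 0 =
        f 0 * (L s + Complex.exp (Real.pi * Complex.I * s) * L' s) := by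
      have hrow1 : Summable fun n : ℕ => eisensteinTerm f g z s (0, (n : ℤ) + 1) :=
        hrow.comp_injective hinj1
      have hrow2 : Summable fun n : ℕ => eisensteinTerm f g z s (0, -((n : ℤ) + 1)) :=
        hrow.comp_injective hinj2
      rw [hr_def]
      simp only
      rw [tsum_of_add_one_of_neg_add_one (f := fun n : ℤ => eisensteinTerm f g z s (0, n))
        hrow1 hrow2]
      have e4 : eisensteinTerm f g z s (0, 0) = 0 := if_pos rfl
      have e5 : ∀ n : ℕ, eisensteinTerm f g z s (0, -((n : ℤ) + 1)) =
          Complex.exp (Real.pi * Complex.I * s) * (f 0 * (g (-((n + 1 : ℕ) : ℤ)) *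
            ((n + 1 : ℕ) : ℂ) ^ (-s))) := fun n => by
        have hp : ((0, (n : ℤ) + 1) : ℤ × ℤ) ≠ 0 := by
          intro h
          simp [Prod.ext_iff] at h
          omega
        have e6 := eisensteinTerm_neg (f := f) (g := g) (z := z) (s := s) hp (hposU n)
        rw [hpos] at e6
        simpa using e6
      rw [e4, tsum_congr (hpos f g), tsum_congr e5, tsum_mul_left, tsum_mul_left, tsum_mul_left,
        hL s (by linarith), hL' s (by linarith)]
      ring
    rw [e1, e2, e3]
    ring

theorem eisensteinG_spec {k : ℕ} (hk : 0 < k) {f g : ℤ → ℂ}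
    (hf : Function.Periodic f (k : ℤ)) (hg : Function.Periodic g (k : ℤ)) {z : ℂ}
    (hz : 0 < z.im) : IsEisensteinContinuation f g z (eisensteinG f g z) :=
  Classical.epsilon_spec (exists_isEisensteinContinuation hk hf hg hz)

/-! ### Sums over residue classes and Bernoulli functions -/

theorem periodic_eq_of_intCast_eq {M : Type*} {k : ℕ} {F : ℤ → M} (hF : Function.Periodic F (k : ℤ)) {m n : ℤ}
    (h : (m : ZMod k) = n) : F m = F n := by
  rw [ZMod.intCast_eq_intCast_iff_dvd_sub] at h
  obtain ⟨q, hq⟩ := h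
  have := hF.int_mul q m
  rw [← this]
  congr 1
  simp
  linarith

section PeriodicSums

variable {M : Type*} [AddCommMonoid M]

theorem sum_range_eq_sum_zmod {k : ℕ} [NeZero k] (F : ℤ → M) :
    ∑ n ∈ Finset.range k, F n = ∑ x : ZMod k, F x.val := by
  refine Finset.sum_nbij' (fun n => (n : ZMod k)) (fun x => x.val) (fun _ _ => Finset.mem_univ _)
    (fun x _ => Finset.mem_range.2 x.val_lt) (fun n hn => ZMod.val_cast_of_lt (Finset.mem_range.1 hn))
    (fun x _ => ZMod.natCast_zmod_val x) (fun n hn => ?_)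
  rw [ZMod.val_cast_of_lt (Finset.mem_range.1 hn)]

/-- The map `n ↦ en + a` permutes the residues modulo `k` when `e` is prime to `k`. -/
theorem sum_range_affine {k : ℕ} (hk : 0 < k) {F : ℤ → M} (hF : Function.Periodic F (k : ℤ))
    {e : ℤ} (he : IsCoprime e k) (a : ℤ) :
    ∑ n ∈ Finset.range k, F (e * n + a) = ∑ n ∈ Finset.range k, F n := by
  have : NeZero k := ⟨hk.ne'⟩
  rw [sum_range_eq_sum_zmod F, sum_range_eq_sum_zmod (fun n => F (e * n + a))]
  obtain ⟨x, y, hxy⟩ := he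
  have hx : ((x : ℤ) : ZMod k) * e = 1 := by
    have := congrArg (Int.cast : ℤ → ZMod k) hxy
    simpa using this
  let σ : ZMod k ≃ ZMod k :=
    { toFun := fun t => e * t + a
      invFun := fun t => x * (t - a)
      left_inv := fun t => by linear_combination t * hx
      right_inv := fun t => by linear_combination (t - a) * hx }
  refine Fintype.sum_equiv σ _ _ fun t => periodic_eq_of_intCast_eq hF ?_
  simp [σ]

theorem sum_Ioc_add {k : ℕ} (hk : 0 < k) {F : ℤ → M} (hF : Function.Periodic F (k : ℤ)) (a : ℤ) :
    ∑ j ∈ Finset.Ioc (0 : ℤ) k, F (j + a) = ∑ n ∈ Finset.range k, F n := by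
  rw [← sum_range_affine hk hF isCoprime_one_left (a + 1)]
  refine Finset.sum_nbij' (fun j => (j - 1).toNat) (fun n => (n : ℤ) + 1) ?_ ?_ ?_ ?_ ?_
  · intro j hj
    simp only [Finset.mem_Ioc, Finset.mem_range] at *
    omega
  · intro n hn
    simp only [Finset.mem_Ioc, Finset.mem_range] at *
    omega
  · intro j hj
    simp only [Finset.mem_Ioc] at *
    omega
  · intro n hn
    simp
  · intro j hj
    simp only [Finset.mem_Ioc] at *
    congr 1
    rw [Int.toNat_of_nonneg (by omega)]
    ring

theorem sum_Ico_zero (n : ℕ) (F : ℤ → M) :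
    ∑ j ∈ Finset.Ico (0 : ℤ) n, F j = ∑ i ∈ Finset.range n, F i := by
  refine Finset.sum_nbij' (fun j => j.toNat) (fun n => (n : ℤ)) ?_ ?_ ?_ ?_ ?_
  · intro j hj
    simp only [Finset.mem_Ico, Finset.mem_range] at *
    omega
  · intro n hn
    simp only [Finset.mem_Ico, Finset.mem_range] at *
    omega
  · intro j hj
    simp only [Finset.mem_Ico] at *
    omega
  · intro n hn
    simp
  · intro j hj
    simp only [Finset.mem_Ico] at *
    rw [Int.toNat_of_nonneg hj.1]

theorem sum_range_mul_eq (c k : ℕ) (F : ℤ → M) :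
    ∑ n ∈ Finset.range (c * k), F n =
      ∑ m ∈ Finset.range k, ∑ q ∈ Finset.range c, F ((m : ℤ) + k * q) := by
  rw [Finset.sum_comm]
  induction c with
  | zero => simp
  | succ c ih =>
    rw [add_mul, one_mul, Finset.sum_range_add, ih, Finset.sum_range_succ]
    congr 1
    refine Finset.sum_congr rfl fun m _ => ?_
    congr 1
    push_cast
    ring

end PeriodicSums

theorem bernoulliP_add_int (n : ℕ) (x : ℝ) (m : ℤ) : bernoulliP n (x + m) = bernoulliP n x := by
  rw [bernoulliP, Int.fract_add_intCast, bernoulliP]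

theorem periodic_bernoulliP (i : ℕ) {c : ℕ} (hc : 0 < c) (x : ℝ) :
    Function.Periodic (fun n : ℤ => bernoulliP i (x + n / c)) (c : ℤ) := fun n => by
  have hc' : (c : ℝ) ≠ 0 := by exact_mod_cast hc.ne'
  simp only
  rw [← bernoulliP_add_int i (x + n / c) 1]
  congr 1
  push_cast
  field_simp
  ring

theorem bernoulliP_one_of_mem {y : ℝ} (h0 : 0 ≤ y) (h1 : y < 1) :
    bernoulliP 1 y = bernoulliFun 1 y := by
  rw [bernoulliP, Int.fract_eq_self.2 ⟨h0, h1⟩]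
  simp

/-- The endpoint `x = 1` is included because `P₁` takes the value `-1/2` at integers. This matches
the first cone coordinate, which lies in `(0, 1]`, whereas the second lies in `[0, 1)`. -/
theorem bernoulliP_one_neg {x : ℝ} (h0 : 0 < x) (h1 : x ≤ 1) :
    bernoulliP 1 (-x) = -bernoulliFun 1 x := by
  have h2 : Int.fract (-x) = 1 - x := by
    rw [Int.fract_eq_iff]
    exact ⟨by linarith, by linarith, -1, by push_cast; ring⟩
  rw [bernoulliP, h2, bernoulliFun_one, bernoulliFun_one]
  simp
  ring

theorem bernoulliP_two_of_mem {x : ℝ} (h0 : 0 ≤ x) (h1 : x ≤ 1) :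
    bernoulliP 2 x = bernoulliFun 2 x / 2 := by
  rw [bernoulliP]
  rcases h1.lt_or_eq with h | rfl
  · rw [Int.fract_eq_self.2 ⟨h0, h⟩]
    simp
  · rw [Int.fract_one, bernoulliFun_two, bernoulliFun_two]
    simp

theorem bernoulliP_two_neg (x : ℝ) : bernoulliP 2 (-x) = bernoulliP 2 x := by
  rcases eq_or_ne (Int.fract x) 0 with h | h
  · rw [bernoulliP, bernoulliP, Int.fract_neg_eq_zero.2 h, h]
  · rw [bernoulliP, bernoulliP, Int.fract_neg h, bernoulliFun_two, bernoulliFun_two]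
    ring

/-- The distribution relation of the second Bernoulli function. -/
theorem sum_bernoulliP_two {c : ℕ} (hc : 0 < c) (x : ℝ) :
    ∑ q ∈ Finset.range c, bernoulliP 2 (x + q / c) = bernoulliP 2 (c * x) / c := by
  have hc' : (0 : ℝ) < c := by exact_mod_cast hc
  set j : ℤ := ⌊c * x⌋ with hj
  set x₀ : ℝ := Int.fract (c * x) / c with hx₀
  have hx : x = x₀ + j / c := by
    rw [hx₀, ← add_div, hj, Int.fract_add_floor]
    field_simp
  have h1 : 0 ≤ x₀ := div_nonneg (Int.fract_nonneg _) hc'.le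
  have h2 : c * x₀ < 1 := by
    rw [hx₀, mul_div_cancel₀ _ hc'.ne']
    exact Int.fract_lt_one _
  have hper := periodic_bernoulliP 2 hc x₀
  -- Shifting the summation index by `⌊cx⌋` reduces to `0 ≤ x < 1/c`, where every argument lies in
  -- `[0, 1]` and the multiplication theorem for Bernoulli polynomials applies.
  have h3 := sum_range_affine hc hper isCoprime_one_left j
  have h4 : bernoulliP 2 (c * x) = bernoulliFun 2 (c * x₀) / 2 := by
    have h5 : c * x = c * x₀ + j := by
      rw [hx]
      field_simp
    rw [h5, bernoulliP_add_int, bernoulliP_two_of_mem (by positivity) h2.le]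
  rw [h4, bernoulliFun_mul 2 hc.ne']
  have h5 : ∀ q ∈ Finset.range c, bernoulliP 2 (x₀ + (q : ℤ) / c) = bernoulliFun 2 (x₀ + q / c) / 2 :=
    fun q hq => by
      have hq' : ((q : ℝ) + 1) ≤ c := by exact_mod_cast Finset.mem_range.1 hq
      rw [Int.cast_natCast, bernoulliP_two_of_mem (by positivity)]
      rw [← sub_nonneg]
      have : 1 - (x₀ + q / c) = (c - (c * x₀ + q)) / c := by field_simp
      rw [this]
      exact div_nonneg (by linarith) hc'.le
  have h6 : ∀ q ∈ Finset.range c, bernoulliP 2 (x + q / c) =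
      bernoulliP 2 (x₀ + ((1 * (q : ℤ) + j : ℤ) : ℝ) / c) := fun q _ => by
    congr 1
    rw [hx]
    push_cast
    ring
  rw [Finset.sum_congr rfl h6, h3, Finset.sum_congr rfl h5, ← Finset.sum_div]
  field_simp

theorem sum_bernoulliP_two_coprime {c : ℕ} (hc : 0 < c) {d : ℤ} (hd : IsCoprime d c) (x : ℝ) :
    ∑ q ∈ Finset.range c, bernoulliP 2 (x - d * q / c) = bernoulliP 2 (c * x) / c := by
  have hper := periodic_bernoulliP 2 hc x
  have h3 := sum_range_affine hc hper hd.neg_left 0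
  rw [← sum_bernoulliP_two hc]
  refine Eq.trans (Finset.sum_congr rfl fun q _ => ?_) (h3.trans (by simp))
  congr 1
  push_cast
  ring

/-! ### Periodic Bernoulli numbers and the Dedekind sum -/

/-- Comparison of the coefficients of `t^(N+1)` in the generating identity. The cases `N = 0, 1, 2`
form a triangular system for the first three periodic Bernoulli numbers. -/
theorem sum_periodicBernoulli {k : ℕ} (hk : 0 < k) (f : ℤ → ℂ) (N : ℕ) :
    ∑ x ∈ Finset.HasAntidiagonal.antidiagonal (N + 1), periodicBernoulli k f x.1 / (x.1.factorial : ℂ) *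
        ((k : ℂ) ^ x.2 / (x.2.factorial : ℂ) - if x.2 = 0 then 1 else 0) =
      ∑ n ∈ Finset.range k, f n * ((n : ℂ) ^ N / (N.factorial : ℂ)) := by
  have h := congrArg (PowerSeries.coeff (N + 1)) (periodicBernoulli_generating k hk f)
  rw [PowerSeries.coeff_mul] at h
  simp_rw [map_sum, PowerSeries.coeff_succ_X_mul, PowerSeries.coeff_C_mul,
    PowerSeries.coeff_rescale, PowerSeries.coeff_exp, PowerSeries.coeff_mk, map_sub,
    PowerSeries.coeff_one, PowerSeries.coeff_rescale, PowerSeries.coeff_exp] at h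
  simpa [div_eq_mul_inv] using h

theorem periodicBernoulli_zero {k : ℕ} (hk : 0 < k) (f : ℤ → ℂ) :
    periodicBernoulli k f 0 = (∑ n ∈ Finset.range k, f n) / k := by
  have hk' : (k : ℂ) ≠ 0 := by exact_mod_cast hk.ne'
  have h := sum_periodicBernoulli hk f 0
  simp [Finset.Nat.antidiagonal_succ] at h
  rw [eq_div_iff hk', h]

theorem periodicBernoulli_two {k : ℕ} (hk : 0 < k) (f : ℤ → ℂ) :
    periodicBernoulli k f 2 = 2 * k * ∑ n ∈ Finset.range k, f n * (bernoulliP 2 (n / k) : ℂ) := by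
  have hk' : (k : ℂ) ≠ 0 := by exact_mod_cast hk.ne'
  have hkr : (0 : ℝ) < k := by exact_mod_cast hk
  have h0 := sum_periodicBernoulli hk f 0
  have h1 := sum_periodicBernoulli hk f 1
  have h2 := sum_periodicBernoulli hk f 2
  simp [Finset.Nat.antidiagonal_succ, Nat.factorial] at h0 h1 h2
  have h3 : ∀ n ∈ Finset.range k, f n * (bernoulliP 2 (n / k) : ℂ) =
      (f n * ((n : ℂ) ^ 2 / 2)) / k ^ 2 - f n * n / (2 * k) + f n / 12 := fun n hn => by
    have hn' : (n : ℝ) ≤ k := by exact_mod_cast (Finset.mem_range.1 hn).le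
    rw [bernoulliP_two_of_mem (by positivity) ((div_le_one hkr).2 hn'), bernoulliFun_two]
    push_cast
    field_simp
    ring
  rw [Finset.sum_congr rfl h3, Finset.sum_add_distrib, Finset.sum_sub_distrib, ← Finset.sum_div,
    ← Finset.sum_div, ← Finset.sum_div, ← h0, ← h1, ← h2]
  field_simp
  ring

theorem periodicP_one (k : ℕ) (V : ℤ → ℂ) (x : ℝ) : periodicP k V 1 x =
    ∑ m ∈ Finset.range k, V (-(m : ℤ)) * (bernoulliP 1 (((m : ℝ) + x) / (k : ℝ)) : ℂ) := by
  simp [periodicP]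

theorem periodic_mul {k : ℕ} {f : ℤ → ℂ} (hf : Function.Periodic f (k : ℤ)) (e : ℤ) :
    Function.Periodic (fun n => f (e * n)) (k : ℤ) := fun n => by
  simp only [mul_add]
  exact hf.int_mul e (e * n)

theorem periodic_bernoulliP_div (i : ℕ) {k : ℕ} (hk : 0 < k) (x : ℝ) :
    Function.Periodic (fun n : ℤ => bernoulliP i ((n + x) / k)) (k : ℤ) := fun n => by
  have := periodic_bernoulliP i hk (x / k) n
  simp only at this ⊢
  rw [← add_div, ← add_div] at this
  rw [add_comm _ x, this, add_comm x]

theorem add_mul_periodic {k : ℕ} {U : ℤ → ℂ} (hU : Function.Periodic U (k : ℤ)) (m q : ℤ) :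
    U (m + k * q) = U m := by
  have := hU.int_mul q m
  rw [mul_comm]
  simpa using this

theorem dedekindSum_eq {k c : ℕ} (hk : 0 < k) (hc : 0 < c) (d : ℤ) {U V : ℤ → ℂ}
    (hU : Function.Periodic U (k : ℤ)) (hV : Function.Periodic V (k : ℤ)) :
    dedekindSum k d c U V = ∑ M ∈ Finset.range (c * k), ∑ n ∈ Finset.range k,
      U M * V n * (bernoulliP 1 ((-(n : ℝ) + d * M / c) / k) * bernoulliP 1 (M / (c * k))) := by
  have hck : 0 < c * k := Nat.mul_pos hc hk
  have hc' : (c : ℝ) ≠ 0 := by exact_mod_cast hc.ne'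
  have hk' : (k : ℝ) ≠ 0 := by exact_mod_cast hk.ne'
  set F : ℤ → ℂ := fun n => U n * (bernoulliP 1 ((n : ℝ) / ((c : ℝ) * (k : ℝ))) : ℂ) *
      periodicP k V 1 ((d : ℝ) * (n : ℝ) / (c : ℝ)) with hF
  have hFp : Function.Periodic F ((c * k : ℕ) : ℤ) := fun n => by
    have h1 : U (n + (c * k : ℕ)) = U n := by
      rw [← add_mul_periodic hU n c]
      push_cast
      ring_nf
    have h2 := periodic_bernoulliP 1 hck 0 n
    simp only [zero_add] at h2
    have h3 : periodicP k V 1 ((d : ℝ) * ((n + (c * k : ℕ) : ℤ) : ℝ) / (c : ℝ)) =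
        periodicP k V 1 ((d : ℝ) * (n : ℝ) / (c : ℝ)) := by
      rw [periodicP_one, periodicP_one]
      refine Finset.sum_congr rfl fun m _ => ?_
      rw [← bernoulliP_add_int 1 ((m + (d : ℝ) * (n : ℝ) / c) / k) d]
      congr 3
      push_cast
      field_simp
      ring
    simp only [hF]
    rw [h1, h3]
    push_cast at h2 ⊢
    rw [h2]
  have h1 : dedekindSum k d c U V = ∑ n ∈ Finset.range (c * k), F n := by
    rw [← sum_Ioc_add hck hFp 0, dedekindSum]
    push_cast
    refine Finset.sum_congr ?_ fun n _ => by simp [hF]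
    ext n
    simp only [Finset.mem_Icc, Finset.mem_Ioc]
    omega
  rw [h1]
  refine Finset.sum_congr rfl fun M _ => ?_
  simp only [hF, periodicP_one, Finset.mul_sum]
  set H : ℤ → ℂ := fun n => V n * (bernoulliP 1 (((-n : ℤ) + (d : ℝ) * (M : ℝ) / c) / k) : ℂ) with hH
  have hHp : Function.Periodic H (k : ℤ) := fun n => by
    have e1 := (periodic_bernoulliP_div 1 hk ((d : ℝ) * M / c)).neg (-n)
    simp only [hH]
    rw [hV n, neg_add]
    have e2 : bernoulliP 1 ((((-n + -(k : ℤ) : ℤ) : ℝ) + (d : ℝ) * M / c) / k) =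
        bernoulliP 1 ((((-n : ℤ) : ℝ) + (d : ℝ) * M / c) / k) := e1
    rw [e2]
  have h2 := sum_range_affine hk hHp (e := -1) isCoprime_one_left.neg_left 0
  have h3 : ∑ n ∈ Finset.range k, V (-(n : ℤ)) *
      (bernoulliP 1 ((n + (d : ℝ) * M / c) / k) : ℂ) = ∑ n ∈ Finset.range k, H n := by
    rw [← h2]
    refine Finset.sum_congr rfl fun n _ => ?_
    simp [hH]
  simp only [Int.cast_natCast]
  rw [← Finset.mul_sum, h3, Finset.mul_sum]
  refine Finset.sum_congr rfl fun n _ => ?_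
  simp only [hH]
  push_cast
  ring

/-- Since the coordinates lie in `(0, 1]` and `[0, 1)`, Bernoulli polynomials may be replaced by
periodic Bernoulli functions. The product of the `B₁` becomes minus the Dedekind summand, and the
`B₂` terms are summed by the distribution relation over `M = m + kq`. -/
theorem sum_coneValue {k c : ℕ} (hk : 0 < k) (hc : 0 < c) {d : ℤ} (hd : IsCoprime d c)
    {U V : ℤ → ℂ} (hU : Function.Periodic U (k : ℤ)) (hV : Function.Periodic V (k : ℤ)) (z : ℂ) :
    ∑ i ∈ coneBox k c, U i.1 * V (coneShift c d i) * coneValue k c d z i =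
      -dedekindSum k d c U V +
        (∑ m ∈ Finset.range k, ∑ n ∈ Finset.range k,
          U m * V n * (bernoulliP 2 ((c * n - d * m) / k) : ℂ)) / c / (c * z + d) +
        (∑ n ∈ Finset.range k, V n) * (∑ m ∈ Finset.range k, U m * (bernoulliP 2 (m / k) : ℂ)) / c *
          (c * z + d) := by
  have hc' : (c : ℝ) ≠ 0 := by exact_mod_cast hc.ne'
  have hk' : (k : ℝ) ≠ 0 := by exact_mod_cast hk.ne'
  have hcZ : (0 : ℤ) < c := by exact_mod_cast hc
  set τ : ℂ := c * z + d with hτ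
  -- With periodic functions the summand depends on `N` only modulo `k`, so the shift by `⌊dM/c⌋` in
  -- the representatives can be dropped. The sign of the `P₁` argument is chosen to fit the endpoint
  -- `x = 1`.
  set G : ℤ → ℤ → ℂ := fun M N => U M * V N *
    (-(bernoulliP 1 ((-N + d * M / c) / k) * bernoulliP 1 (M / (c * k)) : ℂ) +
      (bernoulliP 2 ((N - d * M / c) / k) : ℂ) / τ + (bernoulliP 2 (M / (c * k)) : ℂ) * τ) with hG
  have hGp : ∀ M, Function.Periodic (G M) (k : ℤ) := fun M N => by
    have e1 : bernoulliP 1 ((-((N + k : ℤ) : ℝ) + d * M / c) / k) =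
        bernoulliP 1 ((-(N : ℝ) + d * M / c) / k) := by
      rw [← bernoulliP_add_int 1 _ 1]
      congr 1
      push_cast
      field_simp
      ring
    have e2 : bernoulliP 2 ((((N + k : ℤ) : ℝ) - d * M / c) / k) =
        bernoulliP 2 (((N : ℝ) - d * M / c) / k) := by
      rw [← bernoulliP_add_int 2 (((N : ℝ) - d * M / c) / k) 1]
      congr 1
      push_cast
      field_simp
      ring
    simp only [hG]
    rw [hV N, e1, e2]
  have hterm : ∀ i ∈ coneBox k c, U i.1 * V (coneShift c d i) * coneValue k c d z i =
      G i.1 (coneShift c d i) := fun i hi => by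
    have hx0 := coneX_pos hk hcZ d hi
    have hx1 := coneX_le_one hk hcZ d hi
    have hy0 := coneY_nonneg hcZ hi
    have hy1 : coneY k c i < 1 := by
      simp only [coneBox, Finset.mem_product, Finset.mem_Ico, Finset.mem_Ioc] at hi
      have h4 : (0 : ℝ) < c * k := by positivity
      have h5 : (i.1 : ℝ) < c * k := by exact_mod_cast hi.1.2
      rw [coneY, Int.cast_natCast, div_lt_one h4]
      exact h5
    have ex : ((coneShift c d i : ℝ) - d * i.1 / c) / k = coneX k c d i := by
      rw [coneX, Int.cast_natCast]
    have ex' : (-(coneShift c d i : ℝ) + d * i.1 / c) / k = -coneX k c d i := by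
      rw [← ex]
      ring
    have ey : (i.1 : ℝ) / (c * k) = coneY k c i := by rw [coneY, Int.cast_natCast]
    simp only [hG]
    rw [ex, ex', ey, bernoulliP_one_neg hx0 hx1, bernoulliP_one_of_mem hy0 hy1,
      bernoulliP_two_of_mem hx0.le hx1, bernoulliP_two_of_mem hy0 hy1.le, coneValue,
      Int.cast_natCast, ← hτ]
    push_cast
    ring
  have hck : ((c : ℤ) * (k : ℤ)) = ((c * k : ℕ) : ℤ) := by push_cast; ring
  rw [Finset.sum_congr rfl hterm, coneBox, Finset.sum_product, hck, sum_Ico_zero (c * k)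
    (fun M => ∑ j ∈ Finset.Ioc (0 : ℤ) k, G M (coneShift c d (M, j)))]
  have h1 : ∀ M : ℤ, ∑ j ∈ Finset.Ioc (0 : ℤ) k, G M (coneShift c d (M, j)) =
      ∑ n ∈ Finset.range k, G M n := fun M => sum_Ioc_add hk (hGp M) (d * M / c)
  simp only [h1]
  have hA := dedekindSum_eq hk hc d hU hV
  have hB : ∑ M ∈ Finset.range (c * k), ∑ n ∈ Finset.range k,
      U M * V n * (bernoulliP 2 ((n - d * M / c) / k) : ℂ) =
      (∑ m ∈ Finset.range k, ∑ n ∈ Finset.range k,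
          U m * V n * (bernoulliP 2 ((c * n - d * m) / k) : ℂ)) / c := by
    have h2 := sum_range_mul_eq c k (fun M : ℤ => ∑ n ∈ Finset.range k,
      U M * V n * (bernoulliP 2 ((n - d * M / c) / k) : ℂ))
    simp only [Int.cast_natCast] at h2
    rw [h2, Finset.sum_div]
    refine Finset.sum_congr rfl fun m _ => ?_
    rw [Finset.sum_comm, Finset.sum_div]
    refine Finset.sum_congr rfl fun n _ => ?_
    -- Replacing `m` by `m + kq` moves the argument by `-dq/c`. As `d` is prime to `c`, this runs
    -- over all multiples of `1/c` modulo `1`.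
    have h3 := sum_bernoulliP_two_coprime hc hd ((n - d * m / c) / k)
    have h4 : (c : ℝ) * ((n - d * m / c) / k) = (c * n - d * m) / k := by field_simp
    rw [h4] at h3
    have h5 := congrArg (Complex.ofReal) h3
    push_cast at h5
    rw [mul_div_assoc, ← h5, Finset.mul_sum]
    refine Finset.sum_congr rfl fun q _ => ?_
    rw [add_mul_periodic hU]
    congr 3
    push_cast
    field_simp
    ring
  have hC : ∑ M ∈ Finset.range (c * k), ∑ n ∈ Finset.range k,
      U M * V n * (bernoulliP 2 (M / (c * k)) : ℂ) =
      (∑ n ∈ Finset.range k, V n) * (∑ m ∈ Finset.range k, U m * (bernoulliP 2 (m / k) : ℂ)) / c := by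
    have h2 := sum_range_mul_eq c k (fun M : ℤ => ∑ n ∈ Finset.range k,
      U M * V n * (bernoulliP 2 (M / (c * k)) : ℂ))
    simp only [Int.cast_natCast] at h2
    rw [h2, mul_comm (∑ n ∈ Finset.range k, V n), Finset.sum_mul, Finset.sum_div]
    refine Finset.sum_congr rfl fun m _ => ?_
    rw [Finset.sum_comm, Finset.mul_sum, Finset.sum_div]
    refine Finset.sum_congr rfl fun n _ => ?_
    have h3 := sum_bernoulliP_two hc (m / (c * k))
    have h4 : (c : ℝ) * (m / (c * k)) = m / k := by field_simp
    rw [h4] at h3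
    have h5 := congrArg (Complex.ofReal) h3
    push_cast at h5
    rw [mul_right_comm, mul_div_assoc, ← h5, Finset.mul_sum]
    refine Finset.sum_congr rfl fun q _ => ?_
    rw [add_mul_periodic hU]
    congr 3
    push_cast
    field_simp
  rw [hA, ← hB, ← hC]
  simp only [Finset.sum_div, Finset.sum_mul, ← Finset.sum_neg_distrib, ← Finset.sum_add_distrib]
  refine Finset.sum_congr rfl fun M _ => Finset.sum_congr rfl fun n _ => ?_
  simp only [hG, Int.cast_natCast]
  ring

theorem periodicP_two_zero {k : ℕ} (hk : 0 < k) {U : ℤ → ℂ} (hU : Function.Periodic U (k : ℤ)) :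
    periodicP k U 2 0 = k * ∑ m ∈ Finset.range k, U m * (bernoulliP 2 (m / k) : ℂ) := by
  have h1 : Function.Periodic (fun m : ℤ => U m * (bernoulliP 2 (m / k) : ℂ)) (k : ℤ) := fun m => by
    have := periodic_bernoulliP 2 hk 0 m
    simp only [zero_add] at this
    simp only
    rw [hU m, this]
  have h2 := sum_range_affine hk h1 (e := -1) isCoprime_one_left.neg_left 0
  simp only [periodicP, pow_one]
  congr 1
  simp only [Int.cast_natCast] at h2
  rw [← h2]
  refine Finset.sum_congr rfl fun m _ => ?_
  push_cast
  rw [add_zero, add_zero, add_zero, neg_one_mul, neg_one_mul, neg_div, bernoulliP_two_neg]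

theorem bernoulliP_two_congr {k : ℕ} (hk : 0 < k) {x y : ℤ} (q : ℤ) (h : x = y + k * q) :
    bernoulliP 2 ((x : ℝ) / k) = bernoulliP 2 ((y : ℝ) / k) := by
  have hk' : (k : ℝ) ≠ 0 := by exact_mod_cast hk.ne'
  rw [← bernoulliP_add_int 2 ((y : ℝ) / k) q, h]
  congr 1
  push_cast
  field_simp

/-! ### The transformation formula -/

theorem tendsto_gamma_mul_eisensteinG_sub {k : ℕ} (hk : 0 < k) {f g u v U V : ℤ → ℂ}
    (hf : Function.Periodic f (k : ℤ)) (hg : Function.Periodic g (k : ℤ))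
    (hu : Function.Periodic u (k : ℤ)) (hv : Function.Periodic v (k : ℤ))
    {a b c d : ℤ} (hdet : a * d - b * c = 1) (hc : 0 < c) {z : ℂ} (hz : 0 < z.im)
    (huv : ∀ m n, f (d * m - c * n) * g (-b * m + a * n) = u m * v n)
    (hU : ∀ n, u (-n) = U n) (hV : ∀ n, v (-n) = V n) :
    IsEisensteinContinuation f g ((a * z + b) / (c * z + d))
        (eisensteinG f g ((a * z + b) / (c * z + d))) ∧
      IsEisensteinContinuation u v z (eisensteinG u v z) ∧
      Tendsto (fun s : ℂ => Complex.Gamma s * (branchPow (c * z + d) (-s) *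
          eisensteinG f g ((a * z + b) / (c * z + d)) s - eisensteinG u v z s)) (𝓝[≠] 0)
        (𝓝 (2 * Real.pi * Complex.I * dedekindSum k d c U V -
          2 * Real.pi * Complex.I * (∑ m ∈ Finset.range k, ∑ n ∈ Finset.range k,
            U m * V n * (bernoulliP 2 (((c * n - d * m : ℤ) : ℝ) / k) : ℂ)) / (c * (c * z + d)) -
          2 * Real.pi * Complex.I * ((c * z + d) / c) * (∑ n ∈ Finset.range k, V n) *
            (∑ m ∈ Finset.range k, U m * (bernoulliP 2 (m / k) : ℂ)))) := by
  have hτ : (c * z + d : ℂ) ≠ 0 := IsUpper.ne_zero (Or.inl (linear_im_pos hc hz))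
  have him : 0 < ((a * z + b) / (c * z + d)).im := by
    have h1 := im_div_linear (c := c) (d := d) (z := z) (a, b)
    simp only at h1
    have h2 : a * d - b * c = 1 := hdet
    rw [h1, h2]
    have := Complex.normSq_pos.2 hτ
    positivity
  have hs1 := eisensteinG_spec hk hf hg him
  have hs2 := eisensteinG_spec hk hu hv hz
  refine ⟨hs1, hs2, ?_⟩
  have hlim := tendsto_gamma_mul_continuation_sub hk hu hv hdet hc hz huv hs1 hs2
  convert hlim using 2
  have hU' : Function.Periodic U (k : ℤ) := fun n => by
    rw [← hU, ← hU]
    exact periodic_neg hu n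
  have hV' : Function.Periodic V (k : ℤ) := fun n => by
    rw [← hV, ← hV]
    exact periodic_neg hv n
  simp only [hU, hV]
  lift c to ℕ using hc.le
  have hc' : 0 < c := by exact_mod_cast hc
  have hd : IsCoprime d c := ⟨a, -b, by linarith⟩
  have hcC : (c : ℂ) ≠ 0 := by exact_mod_cast hc'.ne'
  rw [sum_coneValue hk hc' hd hU' hV']
  push_cast at hτ ⊢
  generalize (∑ m ∈ Finset.range k, ∑ n ∈ Finset.range k,
    U m * V n * (bernoulliP 2 ((c * n - d * m) / k) : ℂ)) = X
  generalize dedekindSum k d c U V = Y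
  field_simp
  ring

end PeriodicEisenstein

theorem mainTheorem3 (k : ℕ) (hk : 0 < k) (f g : ℤ → ℂ)
    (hf : Function.Periodic f (k : ℤ)) (hg : Function.Periodic g (k : ℤ))
    (a b c d : ℤ) (hdet : a * d - b * c = 1) (hc : 0 < c) (z : ℂ) (hz : 0 < z.im) :
    (a ≡ 0 [ZMOD (k : ℤ)] → d ≡ 0 [ZMOD (k : ℤ)] →
      PeriodicEisenstein.IsEisensteinContinuation f g ((a * z + b) / (c * z + d))
        (PeriodicEisenstein.eisensteinG f g ((a * z + b) / (c * z + d))) ∧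
      PeriodicEisenstein.IsEisensteinContinuation
        (PeriodicEisenstein.dilate g (-b)) (PeriodicEisenstein.dilate f (-c)) z
        (PeriodicEisenstein.eisensteinG
          (PeriodicEisenstein.dilate g (-b)) (PeriodicEisenstein.dilate f (-c)) z) ∧
      Tendsto
        (fun s : ℂ => Complex.Gamma s *
          (PeriodicEisenstein.branchPow (c * z + d) (-s) *
              PeriodicEisenstein.eisensteinG f g ((a * z + b) / (c * z + d)) s -
            PeriodicEisenstein.eisensteinG
              (PeriodicEisenstein.dilate g (-b)) (PeriodicEisenstein.dilate f (-c)) z s))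
        (𝓝[≠] 0)
        (𝓝 (2 * (Real.pi : ℂ) * Complex.I *
              PeriodicEisenstein.dedekindSum k d c
                (PeriodicEisenstein.dilate g b) (PeriodicEisenstein.dilate f c)
            - (Real.pi : ℂ) * Complex.I / (c * (c * z + d)) *
                PeriodicEisenstein.periodicBernoulli k g 0 *
                PeriodicEisenstein.periodicBernoulli k f 2
            - 2 * (Real.pi : ℂ) * Complex.I * ((c * z + d) / c) *
                PeriodicEisenstein.periodicBernoulli k f 0 *
                PeriodicEisenstein.periodicP k (PeriodicEisenstein.dilate g b) 2 0))) ∧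
    (b ≡ 0 [ZMOD (k : ℤ)] → c ≡ 0 [ZMOD (k : ℤ)] →
      PeriodicEisenstein.IsEisensteinContinuation f g ((a * z + b) / (c * z + d))
        (PeriodicEisenstein.eisensteinG f g ((a * z + b) / (c * z + d))) ∧
      PeriodicEisenstein.IsEisensteinContinuation
        (PeriodicEisenstein.dilate f d) (PeriodicEisenstein.dilate g a) z
        (PeriodicEisenstein.eisensteinG
          (PeriodicEisenstein.dilate f d) (PeriodicEisenstein.dilate g a) z) ∧
      Tendsto
        (fun s : ℂ => Complex.Gamma s *
          (PeriodicEisenstein.branchPow (c * z + d) (-s) *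
              PeriodicEisenstein.eisensteinG f g ((a * z + b) / (c * z + d)) s -
            PeriodicEisenstein.eisensteinG
              (PeriodicEisenstein.dilate f d) (PeriodicEisenstein.dilate g a) z s))
        (𝓝[≠] 0)
        (𝓝 (2 * (Real.pi : ℂ) * Complex.I *
              PeriodicEisenstein.dedekindSum k d c
                (PeriodicEisenstein.dilate f (-d)) (PeriodicEisenstein.dilate g (-a))
            - (Real.pi : ℂ) * Complex.I / (c * (c * z + d)) *
                PeriodicEisenstein.periodicBernoulli k g 0 *
                PeriodicEisenstein.periodicBernoulli k f 2
            - 2 * (Real.pi : ℂ) * Complex.I * ((c * z + d) / c) *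
                PeriodicEisenstein.periodicBernoulli k g 0 *
                PeriodicEisenstein.periodicP k (PeriodicEisenstein.dilate f d) 2 0))) := by
  have hk' : (k : ℂ) ≠ 0 := by exact_mod_cast hk.ne'
  have hcC : (c : ℂ) ≠ 0 := by exact_mod_cast hc.ne'
  have hτ : (c * z + d : ℂ) ≠ 0 :=
    PeriodicEisenstein.IsUpper.ne_zero (Or.inl (PeriodicEisenstein.linear_im_pos hc hz))
  have hp : ∀ {h : ℤ → ℂ}, Function.Periodic h (k : ℤ) → ∀ e, Function.Periodic
      (PeriodicEisenstein.dilate h e) (k : ℤ) := fun h e => PeriodicEisenstein.periodic_mul h e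
  have hcop : ∀ {h : ℤ → ℂ}, Function.Periodic h (k : ℤ) → ∀ {e : ℤ}, IsCoprime e k →
      ∑ n ∈ Finset.range k, h (e * n) = ∑ n ∈ Finset.range k, h n := fun h e he => by
    simpa using PeriodicEisenstein.sum_range_affine hk h he 0
  have hfP : Function.Periodic (fun n : ℤ =>
      f n * (PeriodicEisenstein.bernoulliP 2 (n / k) : ℂ)) (k : ℤ) := fun n => by
    have := PeriodicEisenstein.periodic_bernoulliP 2 hk 0 n
    simp only [zero_add] at this
    simp only
    rw [hf n, this]
  constructor
  · intro ha hd
    obtain ⟨a', ha'⟩ := Int.modEq_zero_iff_dvd.1 ha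
    obtain ⟨d', hd'⟩ := Int.modEq_zero_iff_dvd.1 hd
    -- From `ad - bc = 1` and `k ∣ a`, both `b` and `c` are invertible modulo `k`.
    have hcb : IsCoprime b (k : ℤ) := ⟨-c, a' * d, by
      linear_combination hdet - d * ha'⟩
    have hcc : IsCoprime c (k : ℤ) := ⟨-b, a' * d, by
      linear_combination hdet - d * ha'⟩
    obtain ⟨h1, h2, h3⟩ := PeriodicEisenstein.tendsto_gamma_mul_eisensteinG_sub hk hf hg
      (hp hg (-b)) (hp hf (-c)) (U := PeriodicEisenstein.dilate g b)
      (V := PeriodicEisenstein.dilate f c) hdet hc hz (fun m n => by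
        have e1 : f (d * m - c * n) = f (-c * n) := by
          rw [← PeriodicEisenstein.add_mul_periodic hf (-c * n) (d' * m), hd']
          ring_nf
        have e2 : g (-b * m + a * n) = g (-b * m) := by
          rw [← PeriodicEisenstein.add_mul_periodic hg (-b * m) (a' * n), ha']
          ring_nf
        rw [e1, e2, mul_comm]
        rfl)
      (fun n => by simp [PeriodicEisenstein.dilate]) (fun n => by simp [PeriodicEisenstein.dilate])
    refine ⟨h1, h2, ?_⟩
    convert h3 using 2
    rw [PeriodicEisenstein.periodicP_two_zero hk (hp hg b),
      PeriodicEisenstein.periodicBernoulli_zero hk, PeriodicEisenstein.periodicBernoulli_zero hk,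
      PeriodicEisenstein.periodicBernoulli_two hk]
    -- Since `k ∣ d`, the argument is `cn/k` modulo `1` and the double sum factors. The
    -- substitutions `n ↦ cn` and `m ↦ bm` then remove the dilations.
    have e3 : ∑ m ∈ Finset.range k, ∑ n ∈ Finset.range k,
        PeriodicEisenstein.dilate g b m * PeriodicEisenstein.dilate f c n *
          (PeriodicEisenstein.bernoulliP 2 (((c * n - d * m : ℤ) : ℝ) / k) : ℂ) =
        (∑ m ∈ Finset.range k, g m) * ∑ n ∈ Finset.range k,
          f n * (PeriodicEisenstein.bernoulliP 2 (n / k) : ℂ) := by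
      have e4 := hcop hfP hcc
      simp only [Int.cast_natCast] at e4
      rw [← hcop hg hcb, ← e4, Finset.sum_mul_sum]
      refine Finset.sum_congr rfl fun m _ => Finset.sum_congr rfl fun n _ => ?_
      rw [PeriodicEisenstein.bernoulliP_two_congr hk (x := c * n - d * m) (y := c * n)
        (-(d' * m)) (by rw [hd']; ring)]
      simp only [PeriodicEisenstein.dilate]
      ring
    have e5 : ∑ n ∈ Finset.range k, PeriodicEisenstein.dilate f c n = ∑ n ∈ Finset.range k, f n :=
      hcop hf hcc
    rw [e3, e5]
    field_simp
  · intro hb hc0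
    obtain ⟨b', hb'⟩ := Int.modEq_zero_iff_dvd.1 hb
    obtain ⟨c', hc'⟩ := Int.modEq_zero_iff_dvd.1 hc0
    have hca : IsCoprime (-a) (k : ℤ) := ⟨-d, -(b' * c), by
      linear_combination hdet + c * hb'⟩
    have hcd : IsCoprime (-d) (k : ℤ) := ⟨-a, -(b' * c), by
      linear_combination hdet + c * hb'⟩
    obtain ⟨h1, h2, h3⟩ := PeriodicEisenstein.tendsto_gamma_mul_eisensteinG_sub hk hf hg
      (hp hf d) (hp hg a) (U := PeriodicEisenstein.dilate f (-d))
      (V := PeriodicEisenstein.dilate g (-a)) hdet hc hz (fun m n => by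
        have e1 : f (d * m - c * n) = f (d * m) := by
          rw [← PeriodicEisenstein.add_mul_periodic hf (d * m) (-(c' * n)), hc']
          ring_nf
        have e2 : g (-b * m + a * n) = g (a * n) := by
          rw [← PeriodicEisenstein.add_mul_periodic hg (a * n) (-(b' * m)), hb']
          ring_nf
        rw [e1, e2]
        rfl)
      (fun n => by simp [PeriodicEisenstein.dilate]) (fun n => by simp [PeriodicEisenstein.dilate])
    refine ⟨h1, h2, ?_⟩
    convert h3 using 2
    -- The reflection built into `periodicP` turns the dilation by `d` into the one by `-d`, so
    -- evenness of `P₂` is not needed here.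
    have e0 : PeriodicEisenstein.periodicP k (PeriodicEisenstein.dilate f d) 2 0 =
        k * ∑ m ∈ Finset.range k, PeriodicEisenstein.dilate f (-d) m *
          (PeriodicEisenstein.bernoulliP 2 (m / k) : ℂ) := by
      simp [PeriodicEisenstein.periodicP, PeriodicEisenstein.dilate]
    rw [e0,
      PeriodicEisenstein.periodicBernoulli_zero hk, PeriodicEisenstein.periodicBernoulli_two hk]
    -- Now `k ∣ c`, so the argument is `-dm/k` modulo `1`, which is why `-d` and `-a` serve as the
    -- invertible multipliers.
    have e3 : ∑ m ∈ Finset.range k, ∑ n ∈ Finset.range k,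
        PeriodicEisenstein.dilate f (-d) m * PeriodicEisenstein.dilate g (-a) n *
          (PeriodicEisenstein.bernoulliP 2 (((c * n - d * m : ℤ) : ℝ) / k) : ℂ) =
        (∑ m ∈ Finset.range k, g m) * ∑ n ∈ Finset.range k,
          f n * (PeriodicEisenstein.bernoulliP 2 (n / k) : ℂ) := by
      have e4 := hcop hfP hcd
      simp only [Int.cast_natCast] at e4
      rw [← hcop hg hca, ← e4, Finset.sum_mul_sum, Finset.sum_comm]
      refine Finset.sum_congr rfl fun m _ => Finset.sum_congr rfl fun n _ => ?_
      rw [PeriodicEisenstein.bernoulliP_two_congr hk (x := c * m - d * n) (y := -d * n)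
        (c' * m) (by rw [hc']; ring)]
      simp only [PeriodicEisenstein.dilate]
      ring
    have e5 : ∑ n ∈ Finset.range k, PeriodicEisenstein.dilate g (-a) n = ∑ n ∈ Finset.range k, g n :=
      hcop hg hca
    rw [e3, e5]
    field_simp
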